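/- Let $B=(B_u)_{u\ge 0}$ be a one-dimensional fractional Brownian motion with Hurst parameter $H=\tfrac23$, i.e. a centered real-valued Gaussian process with almost surely continuous paths and covariance $$\mathbb{E}[B_uB_v]=\tfrac12\left(u^{4/3}+v^{4/3}-|u-v|^{4/3}\right),\qquad u,v\ge 0.$$ Fix $t>0$. For $\varepsilon>0$ let $f_\varepsilon(x)=(2\pi\varepsilon)^{-1/2}e^{-x^2/(2\varepsilon)}$, $x\in\mathbb{R}$, and define the approximated first-order derivative of the self-intersection local time of $B$ at $0$ by $$\widehat{\alpha}'_{t,\varepsilon}(0)=-\int_{\{(r,s)\,:\,0<r<s<t\}} f'_\varepsilon(B_s-B_r)\,dr\,ds .$$ Then, as $\varepsilon\downarrow 0$, $$\Big(\log\frac1\varepsilon\Big)^{-1}\widehat{\alpha}'_{t,\varepsilon}(0)\ \xrightarrow{\ \mathrm{law}\ }\ N(0,\sigma^2),\qquad \sigma^2=\frac{t^{4/3}}{8\pi}\,B\!\left(2,\tfrac13\right),$$ where $B(\cdot,\cdot)$ in the formula for $\sigma^2$ is the Beta function. -/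

import Mathlib

open MeasureTheory ProbabilityTheory Filter Topology
open scoped NNReal

/-- One-dimensional fractional Brownian motion `B = (B_u)_{u ≥ 0}` with Hurst parameter
`H ∈ (0, 1)`: a centered Gaussian process with covariance
`E[B_u B_v] = (u^{2H} + v^{2H} - |u - v|^{2H}) / 2` and almost surely continuous paths. -/
structure IsFractionalBrownianMotion {Ω : Type*} [MeasurableSpace Ω]
    (B : ℝ≥0 → Ω → ℝ) (H : ℝ) (P : Measure Ω) : Prop where
  hurst_pos : 0 < H
  hurst_lt_one : H < 1
  isGaussianProcess : IsGaussianProcess B P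
  integral_eq_zero : ∀ u : ℝ≥0, ∫ ω, B u ω ∂P = 0
  integral_mul_eq : ∀ u v : ℝ≥0, ∫ ω, B u ω * B v ω ∂P =
    ((u : ℝ) ^ (2 * H) + (v : ℝ) ^ (2 * H) - |(u : ℝ) - (v : ℝ)| ^ (2 * H)) / 2
  continuous_paths : ∀ᵐ ω ∂P, Continuous fun u : ℝ≥0 => B u ω

/-- The heat kernel `f_ε(x) = (2πε)^{-1/2} exp(-x² / (2ε))` on `ℝ` (for `ε > 0`). -/
noncomputable def heatKernel (ε x : ℝ) : ℝ :=
  (√(2 * Real.pi * ε))⁻¹ * Real.exp (-x ^ 2 / (2 * ε))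

/-- The domain `D = {(r, s) : 0 < r < s < t}`. -/
def timeSimplex (t : ℝ) : Set (ℝ × ℝ) :=
  {p | 0 < p.1 ∧ p.1 < p.2 ∧ p.2 < t}

/-- The approximated `k`-th order derivative of the self-intersection local time of a real-valued
process `B`, up to time `t` and at the level `y`:
`(-1)^k ∫_D f_ε^{(k)}(B_s - B_r - y) dr ds`, the integral being taken pathwise.
On `D` the times `r`, `s` are positive, so `Real.toNNReal` only changes their type. -/
noncomputable def approxDSLT {Ω : Type*} (B : ℝ≥0 → Ω → ℝ) (k : ℕ) (t ε y : ℝ) (ω : Ω) : ℝ :=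
  (-1) ^ k * ∫ p in timeSimplex t,
    iteratedDeriv k (heatKernel ε) (B p.2.toNNReal ω - B p.1.toNNReal ω - y)

/-! Each `-f_ε'(B_s - B_r)` is split into its projection on `B_s - B_r` (its first chaos) and the
rest (chaos orders at least three). The first part carries the logarithm and is asymptotically a
deterministic multiple of the single Gaussian variable `B_t - B_0`; the second is of smaller order
in `L²`. The convergence therefore holds even in `L¹`, towards `(3/4) (2π)^{-1/2} (B_t - B_0)`, and
the law of that variable is the stated normal law.

First chaos. With `k = chaosCoef ε`, the integral of `k(s - r) (B_s - B_r)` telescopes for each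
fixed length `u = s - r`: only averages of `B` over windows of width `u` at the two ends of `[0, t]`
survive (`integral_timeSimplex_increment`). As `k(u) ≤ u^{-2}` uniformly in `ε`, replacing these
averages by `u B_t` and `u B_0` costs `O(1)` in `L¹`. The remaining factor is `(2π)^{-1/2} J(ε)`,
where `J(ε) = ∫_0^t u (ε + u^{4/3})^{-3/2} du ~ (3/4) log(1/ε)` (`tendsto_logIntegral`).

Remainder. Its covariance function is explicit (`higherChaosCov`), and its second moment is the
double integral of that function over the simplex. Local nondeterminism, read off the Mandelbrot–Van
Ness kernel, bounds the covariance determinant of two increments from below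
(`exists_det_lower_bound`). Unless the two increments nearly coincide, this yields a bound
integrable uniformly in `ε`; near coincidence it yields a bound with integral `O(J(ε))`
(`exists_higherChaosCov_le`). Hence the remainder has `L²` norm `O((1 + J(ε))^{1/2})`, which
vanishes after division by `log(1/ε)`. -/

/-! ### Gaussian integrals of the heat kernel and its derivative -/

theorem heatKernel_of_nonpos {ε : ℝ} (hε : ε ≤ 0) (x : ℝ) : heatKernel ε x = 0 := by
  have : √(2 * Real.pi * ε) = 0 :=
    Real.sqrt_eq_zero_of_nonpos (mul_nonpos_of_nonneg_of_nonpos (by positivity) hε)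
  simp [heatKernel, this]

theorem heatKernel_eq_gaussianPDFReal (v : ℝ≥0) (m x : ℝ) :
    heatKernel v (x - m) = gaussianPDFReal m v x := by
  simp [heatKernel, gaussianPDFReal]

theorem continuous_heatKernel (ε : ℝ) : Continuous (heatKernel ε) := by
  unfold heatKernel; fun_prop

theorem heatKernel_nonneg (ε x : ℝ) : 0 ≤ heatKernel ε x := by
  unfold heatKernel; positivity

/-- The spatial derivative of the heat kernel. -/
noncomputable def heatKernelDeriv (ε x : ℝ) : ℝ := -(x / ε) * heatKernel ε x

theorem iteratedDeriv_one_heatKernel (ε : ℝ) :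
    iteratedDeriv 1 (heatKernel ε) = heatKernelDeriv ε := by
  funext x
  rw [iteratedDeriv_one]
  have h : HasDerivAt (heatKernel ε)
      ((√(2 * Real.pi * ε))⁻¹ * (Real.exp (-x ^ 2 / (2 * ε)) * (-(2 * x) / (2 * ε)))) x := by
    unfold heatKernel
    refine HasDerivAt.const_mul _ (HasDerivAt.exp ?_)
    simpa using ((hasDerivAt_pow 2 x).neg).div_const (2 * ε)
  have h2 : -(2 * x) / (2 * ε) = -(x / ε) := by
    rw [neg_div, mul_div_mul_left _ _ two_ne_zero]
  rw [h.deriv, heatKernelDeriv, heatKernel, h2]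
  ring

theorem continuous_heatKernelDeriv (ε : ℝ) : Continuous (heatKernelDeriv ε) := by
  unfold heatKernelDeriv
  have := continuous_heatKernel ε
  fun_prop

/-- The bound depends on `ε` and serves only for integrability. For `ε ≤ 0` the kernel vanishes,
since the inverse of `√(2πε) = 0` is `0`. -/
theorem exists_abs_heatKernelDeriv_le (ε : ℝ) : ∃ K, 0 ≤ K ∧ ∀ x, |heatKernelDeriv ε x| ≤ K := by
  rcases le_or_gt ε 0 with hε | hε
  · exact ⟨0, le_rfl, fun x => by simp [heatKernelDeriv, heatKernel_of_nonpos hε]⟩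
  refine ⟨(√(2 * Real.pi * ε))⁻¹ * ((1 + 2 * ε) / ε), by positivity, fun x => ?_⟩
  have h1 : |x| * Real.exp (-x ^ 2 / (2 * ε)) ≤ 1 + 2 * ε := by
    have h2 : Real.exp (-x ^ 2 / (2 * ε)) ≤ 1 := Real.exp_le_one_iff.2 (by
      rw [neg_div]; have : 0 ≤ x ^ 2 / (2 * ε) := by positivity
      linarith)
    have h3 : x ^ 2 / (2 * ε) * Real.exp (-x ^ 2 / (2 * ε)) ≤ 1 := by
      have h4 : x ^ 2 / (2 * ε) ≤ Real.exp (x ^ 2 / (2 * ε)) := by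
        have := Real.add_one_le_exp (x ^ 2 / (2 * ε)); linarith
      rw [neg_div, Real.exp_neg]
      rw [← div_eq_mul_inv, div_le_one (Real.exp_pos _)]
      exact h4
    have h5 : |x| ≤ 1 + x ^ 2 := by
      have := sq_abs x; nlinarith [sq_nonneg (|x| - 1), abs_nonneg x]
    have h6 : x ^ 2 * Real.exp (-x ^ 2 / (2 * ε)) ≤ 2 * ε := by
      have h7 : x ^ 2 * Real.exp (-x ^ 2 / (2 * ε))
          = 2 * ε * (x ^ 2 / (2 * ε) * Real.exp (-x ^ 2 / (2 * ε))) := by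
        field_simp
      rw [h7]; nlinarith
    nlinarith [Real.exp_pos (-x ^ 2 / (2 * ε))]
  have h8 : |heatKernelDeriv ε x|
      = (√(2 * Real.pi * ε))⁻¹ * (|x| * Real.exp (-x ^ 2 / (2 * ε)) / ε) := by
    rw [heatKernelDeriv, abs_mul, abs_neg, abs_div, abs_of_pos hε,
      abs_of_nonneg (heatKernel_nonneg _ _), heatKernel]
    ring
  rw [h8]
  gcongr

/-- Completing the square in `w`: the second factor on the right is a probability density in `w`, so
integrals against the product become Gaussian moments. -/
theorem heatKernel_mul_heatKernel_add {α v : ℝ} (hα : 0 < α) (hv : 0 < v) (y w : ℝ) :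
    heatKernel α (y + w) * heatKernel v w =
      heatKernel (α + v) y * heatKernel (α * v / (α + v)) (w - -(y * v / (α + v))) := by
  unfold heatKernel
  have h1 : (√(2 * Real.pi * α))⁻¹ * (√(2 * Real.pi * v))⁻¹
      = (√(2 * Real.pi * (α + v)))⁻¹ * (√(2 * Real.pi * (α * v / (α + v))))⁻¹ := by
    rw [← mul_inv, ← mul_inv, ← Real.sqrt_mul (by positivity), ← Real.sqrt_mul (by positivity)]
    congr 2
    field_simp
  have h2 : Real.exp (-(y + w) ^ 2 / (2 * α)) * Real.exp (-w ^ 2 / (2 * v))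
      = Real.exp (-y ^ 2 / (2 * (α + v))) *
        Real.exp (-(w - -(y * v / (α + v))) ^ 2 / (2 * (α * v / (α + v)))) := by
    rw [← Real.exp_add, ← Real.exp_add]
    congr 1
    field_simp
    ring
  calc _ = ((√(2 * Real.pi * α))⁻¹ * (√(2 * Real.pi * v))⁻¹) *
        (Real.exp (-(y + w) ^ 2 / (2 * α)) * Real.exp (-w ^ 2 / (2 * v))) := by ring
    _ = _ := by rw [h1, h2]; ring

theorem heatKernel_scale_mul_heatKernel {α v : ℝ} (hα : 0 < α) (hv : 0 < v) (ρ x : ℝ) :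
    heatKernel α (ρ * x) * heatKernel v x =
      heatKernel (α + ρ ^ 2 * v) 0 * heatKernel (α * v / (α + ρ ^ 2 * v)) x := by
  unfold heatKernel
  have h0 : 0 < α + ρ ^ 2 * v := by positivity
  have h1 : (√(2 * Real.pi * α))⁻¹ * (√(2 * Real.pi * v))⁻¹
      = (√(2 * Real.pi * (α + ρ ^ 2 * v)))⁻¹ *
        (√(2 * Real.pi * (α * v / (α + ρ ^ 2 * v))))⁻¹ := by
    rw [← mul_inv, ← mul_inv, ← Real.sqrt_mul (by positivity), ← Real.sqrt_mul (by positivity)]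
    congr 2
    field_simp
  have h2 : Real.exp (-(ρ * x) ^ 2 / (2 * α)) * Real.exp (-x ^ 2 / (2 * v))
      = Real.exp (-0 ^ 2 / (2 * (α + ρ ^ 2 * v))) *
        Real.exp (-x ^ 2 / (2 * (α * v / (α + ρ ^ 2 * v)))) := by
    rw [← Real.exp_add, ← Real.exp_add]
    congr 1
    field_simp
    ring
  calc _ = ((√(2 * Real.pi * α))⁻¹ * (√(2 * Real.pi * v))⁻¹) *
        (Real.exp (-(ρ * x) ^ 2 / (2 * α)) * Real.exp (-x ^ 2 / (2 * v))) := by ring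
    _ = _ := by rw [h1, h2]; ring

theorem integral_gaussianReal_eq_integral_heatKernel {v : ℝ} (hv : 0 < v) (m : ℝ) (f : ℝ → ℝ) :
    ∫ x, f x ∂(gaussianReal m v.toNNReal) = ∫ x, heatKernel v (x - m) * f x := by
  rw [integral_gaussianReal_eq_integral_smul (by simpa using hv)]
  congr 1 with x
  rw [← heatKernel_eq_gaussianPDFReal, Real.coe_toNNReal _ hv.le, smul_eq_mul]

theorem integral_sq_gaussianReal (v : ℝ≥0) : ∫ x, x ^ 2 ∂(gaussianReal 0 v) = v := by
  have h := variance_fun_id_gaussianReal (μ := 0) (v := v)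
  rw [variance_of_integral_eq_zero (by fun_prop) (by simp [integral_id_gaussianReal])] at h
  simpa using h

theorem integral_heatKernel_mul_sq {v : ℝ} (hv : 0 < v) : ∫ x, heatKernel v x * x ^ 2 = v := by
  have h := integral_gaussianReal_eq_integral_heatKernel hv 0 (fun x => x ^ 2)
  rw [integral_sq_gaussianReal, Real.coe_toNNReal _ hv.le] at h
  simpa using h.symm

/-- The differentiated semigroup property of the heat kernel. It integrates out the part of one
increment that is independent of the other. -/
theorem integral_heatKernelDeriv_add_gaussianReal {α : ℝ} (hα : 0 < α) {v : ℝ} (hv : 0 ≤ v)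
    (y : ℝ) :
    ∫ w, heatKernelDeriv α (y + w) ∂(gaussianReal 0 v.toNNReal) = heatKernelDeriv (α + v) y := by
  rcases hv.eq_or_lt with rfl | hv
  · simp
  have hτ : 0 < α * v / (α + v) := by positivity
  rw [integral_gaussianReal_eq_integral_heatKernel hv]
  have h1 : ∀ w, heatKernel v (w - 0) * heatKernelDeriv α (y + w) =
      -(heatKernel (α + v) y / α) *
        (heatKernel (α * v / (α + v)) (w - -(y * v / (α + v))) * (y + w)) := by
    intro w
    have := heatKernel_mul_heatKernel_add hα hv y w
    rw [sub_zero, heatKernelDeriv]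
    calc _ = -((y + w) / α) * (heatKernel α (y + w) * heatKernel v w) := by ring
      _ = _ := by rw [this]; ring
  simp_rw [h1]
  have h2 (m : ℝ) (c : ℝ≥0) : Integrable (fun w : ℝ => w) (gaussianReal m c) :=
    (memLp_id_gaussianReal 1).integrable le_rfl
  rw [integral_const_mul,
    ← integral_gaussianReal_eq_integral_heatKernel hτ (-(y * v / (α + v))) (fun w => y + w),
    integral_add (integrable_const _) (h2 _ _),
    integral_id_gaussianReal]
  simp only [integral_const, probReal_univ, smul_eq_mul, one_mul, heatKernelDeriv]
  field_simp
  ring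

theorem heatKernel_zero_eq (v : ℝ) : heatKernel v 0 = (√(2 * Real.pi * v))⁻¹ := by
  simp [heatKernel]

theorem inv_mul_inv_sqrt_eq_rpow {x : ℝ} (hx : 0 < x) : x⁻¹ * (√x)⁻¹ = x ^ (-(3 / 2) : ℝ) := by
  rw [Real.sqrt_eq_rpow, ← Real.rpow_neg hx.le, ← Real.rpow_neg_one x, ← Real.rpow_add hx]
  norm_num

theorem integral_mul_heatKernelDeriv_gaussianReal {α a : ℝ} (hα : 0 < α) (ha : 0 < a) :
    ∫ x, x * heatKernelDeriv α x ∂(gaussianReal 0 a.toNNReal) =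
      -(a * ((√(2 * Real.pi))⁻¹ * (α + a) ^ (-(3 / 2) : ℝ))) := by
  rw [integral_gaussianReal_eq_integral_heatKernel ha]
  have h1 : ∀ x, heatKernel a (x - 0) * (x * heatKernelDeriv α x) =
      -(heatKernel (α + a) 0 / α) * (heatKernel (α * a / (α + a)) x * x ^ 2) := by
    intro x
    have := heatKernel_scale_mul_heatKernel hα ha 1 x
    rw [one_mul, one_pow, one_mul] at this
    rw [sub_zero, heatKernelDeriv]
    calc _ = -(x ^ 2 / α) * (heatKernel α x * heatKernel a x) := by ring
      _ = _ := by rw [this]; ring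
  simp_rw [h1]
  rw [integral_const_mul, integral_heatKernel_mul_sq (by positivity), heatKernel_zero_eq,
    ← inv_mul_inv_sqrt_eq_rpow (by positivity), Real.sqrt_mul (by positivity)]
  field_simp

/-- Two completions of the square merge the three Gaussian factors into one; the two linear
prefactors leave its second moment. -/
theorem integral_heatKernelDeriv_mul_heatKernelDeriv_gaussianReal {α β a : ℝ} (hα : 0 < α)
    (hβ : 0 < β) (ha : 0 < a) (ρ : ℝ) :
    ∫ x, heatKernelDeriv α x * heatKernelDeriv β (ρ * x) ∂(gaussianReal 0 a.toNNReal) =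
      ρ * a * ((2 * Real.pi)⁻¹ * ((α + a) * β + ρ ^ 2 * (α * a)) ^ (-(3 / 2) : ℝ)) := by
  rw [integral_gaussianReal_eq_integral_heatKernel ha]
  set τ := α * a / (α + a) with hτ
  have hτ0 : 0 < τ := by positivity
  have h1 : ∀ x, heatKernel a (x - 0) * (heatKernelDeriv α x * heatKernelDeriv β (ρ * x)) =
      (ρ / (α * β) * heatKernel (α + a) 0 * heatKernel (β + ρ ^ 2 * τ) 0) *
        (heatKernel (β * τ / (β + ρ ^ 2 * τ)) x * x ^ 2) := by
    intro x
    have h2 := heatKernel_scale_mul_heatKernel hα ha 1 x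
    rw [one_mul, one_pow, one_mul] at h2
    have h3 := heatKernel_scale_mul_heatKernel hβ hτ0 ρ x
    rw [sub_zero, heatKernelDeriv, heatKernelDeriv]
    calc _ = ρ * x ^ 2 / (α * β) * (heatKernel α x * heatKernel a x) *
          heatKernel β (ρ * x) := by ring
      _ = ρ * x ^ 2 / (α * β) * heatKernel (α + a) 0 *
          (heatKernel β (ρ * x) * heatKernel τ x) := by rw [h2]; ring
      _ = _ := by rw [h3]; ring
  simp_rw [h1]
  have hD : (α + a) * β + ρ ^ 2 * (α * a) = (α + a) * (β + ρ ^ 2 * τ) := by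
    rw [hτ]; field_simp
  have hβτ : 0 < β + ρ ^ 2 * τ := by positivity
  rw [integral_const_mul, integral_heatKernel_mul_sq (by positivity), heatKernel_zero_eq,
    heatKernel_zero_eq, hD, ← inv_mul_inv_sqrt_eq_rpow (by positivity),
    Real.sqrt_mul (by positivity) (α + a), Real.sqrt_mul (by positivity : 0 ≤ 2 * Real.pi) (β + _),
    Real.sqrt_mul (by positivity : 0 ≤ α + a)]
  have h5 : (√(2 * Real.pi))⁻¹ * (√(2 * Real.pi))⁻¹ = (2 * Real.pi)⁻¹ := by
    rw [← mul_inv, Real.mul_self_sqrt (by positivity)]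
  have h6 : β * τ = α * a * β / (α + a) := by rw [hτ]; ring
  calc _ = ((√(2 * Real.pi))⁻¹ * (√(2 * Real.pi))⁻¹) *
        (ρ / (α * β) * (√(α + a))⁻¹ * (√(β + ρ ^ 2 * τ))⁻¹ * (β * τ / (β + ρ ^ 2 * τ))) := by
        rw [mul_inv, mul_inv]; ring
    _ = _ := by
      rw [h5, h6, mul_inv, mul_inv]
      field_simp

/-! ### Expectations of functions of a centered Gaussian pair -/

section GaussianPair

variable {Ω : Type*} [MeasurableSpace Ω] {P : Measure Ω} {X Y : Ω → ℝ}

theorem ProbabilityTheory.HasGaussianLaw.map_eq_gaussianReal_of_centered (hX : HasGaussianLaw X P)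
    (hX0 : ∫ ω, X ω ∂P = 0) {a : ℝ} (ha : ∫ ω, X ω * X ω ∂P = a) :
    P.map X = gaussianReal 0 a.toNNReal := by
  rw [hX.map_eq_gaussianReal, variance_of_integral_eq_zero hX.aemeasurable hX0, hX0, ← ha]
  simp [pow_two]

/-- A centered Gaussian pair is disintegrated as `Y = (c / a) X + W` with `W` independent of `X`. -/
theorem ProbabilityTheory.HasGaussianLaw.integral_mul_comp_eq
    (hXY : HasGaussianLaw (fun ω => (X ω, Y ω)) P)
    (hX0 : ∫ ω, X ω ∂P = 0) (hY0 : ∫ ω, Y ω ∂P = 0) {a b c : ℝ} (ha : 0 < a)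
    (hXX : ∫ ω, X ω * X ω ∂P = a) (hYY : ∫ ω, Y ω * Y ω ∂P = b) (hXY' : ∫ ω, X ω * Y ω ∂P = c)
    {h k : ℝ → ℝ} (hh : Continuous h) (hk : Continuous k)
    (hint : Integrable (fun ω => h (X ω) * k (Y ω)) P) :
    0 ≤ b - c ^ 2 / a ∧ ∫ ω, h (X ω) * k (Y ω) ∂P =
      ∫ x, h x * ∫ w, k (c / a * x + w) ∂(gaussianReal 0 (b - c ^ 2 / a).toNNReal)
        ∂(gaussianReal 0 a.toNNReal) := by
  have hP := hXY.isProbabilityMeasure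
  set ρ := c / a with hρ
  set W : Ω → ℝ := fun ω => Y ω - ρ * X ω with hW
  have hXW : HasGaussianLaw (fun ω => (X ω, W ω)) P := by
    have := hXY.map_fun ((ContinuousLinearMap.fst ℝ ℝ ℝ).prod
      (ContinuousLinearMap.snd ℝ ℝ ℝ - ρ • ContinuousLinearMap.fst ℝ ℝ ℝ))
    simpa using this
  have hX2 := hXY.fst.memLp_two
  have hY2 := hXY.snd.memLp_two
  have hW2 := hXW.snd.memLp_two
  have iXX : Integrable (fun ω => X ω * X ω) P := hX2.integrable_mul hX2
  have iXY : Integrable (fun ω => X ω * Y ω) P := hX2.integrable_mul hY2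
  have iYY : Integrable (fun ω => Y ω * Y ω) P := hY2.integrable_mul hY2
  have hW0 : ∫ ω, W ω ∂P = 0 := by
    rw [hW, integral_sub hXY.snd.integrable (hXY.fst.integrable.const_mul ρ), integral_const_mul,
      hX0, hY0]
    simp
  have hWW : ∫ ω, W ω * W ω ∂P = b - c ^ 2 / a := by
    have : ∀ ω, W ω * W ω = Y ω * Y ω - 2 * ρ * (X ω * Y ω) + ρ ^ 2 * (X ω * X ω) := by
      intro ω; simp only [hW]; ring
    simp_rw [this]
    have i1 : Integrable (fun ω => Y ω * Y ω - 2 * ρ * (X ω * Y ω)) P :=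
      iYY.sub (iXY.const_mul _)
    rw [integral_add i1 (iXX.const_mul _),
      integral_sub iYY (iXY.const_mul _), integral_const_mul, integral_const_mul, hXX, hYY, hXY',
      hρ]
    field_simp
    ring
  have hcov : cov[X, W; P] = 0 := by
    rw [covariance_eq_sub hX2 hW2, hX0, zero_mul, sub_zero]
    have : ∀ ω, (X * W) ω = X ω * Y ω - ρ * (X ω * X ω) := by
      intro ω; simp only [hW, Pi.mul_apply]; ring
    simp_rw [this]
    rw [integral_sub iXY (iXX.const_mul _), integral_const_mul, hXX, hXY', hρ]
    field_simp
    ring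
  have hind := hXW.indepFun_of_covariance_eq_zero hcov
  have hlaw := (indepFun_iff_map_prod_eq_prod_map_map hXW.fst.aemeasurable
    hXW.snd.aemeasurable).1 hind
  rw [hXW.fst.map_eq_gaussianReal_of_centered hX0 hXX,
    hXW.snd.map_eq_gaussianReal_of_centered hW0 hWW] at hlaw
  have hmeas : AEMeasurable (fun ω => (X ω, W ω)) P :=
    hXW.fst.aemeasurable.prodMk hXW.snd.aemeasurable
  have hcont : Continuous fun z : ℝ × ℝ => h z.1 * k (ρ * z.1 + z.2) := by fun_prop
  have heq : ∀ ω, h (X ω) * k (Y ω) = (fun z : ℝ × ℝ => h z.1 * k (ρ * z.1 + z.2)) (X ω, W ω) := by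
    intro ω; simp [hW]
  refine ⟨?_, ?_⟩
  · rw [← hWW]; exact integral_nonneg fun ω => mul_self_nonneg _
  simp_rw [heq] at hint ⊢
  have hint2 := (integrable_map_measure (f := fun ω => (X ω, W ω))
    hcont.aestronglyMeasurable hmeas).2 hint
  rw [← integral_map hmeas hcont.aestronglyMeasurable]
  rw [hlaw] at hint2 ⊢
  rw [integral_prod _ hint2]
  simp only [integral_const_mul]

/-- The expectation of a product of two heat kernel derivatives. -/
theorem ProbabilityTheory.HasGaussianLaw.integral_heatKernelDeriv_mul
    (hXY : HasGaussianLaw (fun ω => (X ω, Y ω)) P)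
    (hX0 : ∫ ω, X ω ∂P = 0) (hY0 : ∫ ω, Y ω ∂P = 0) {a b c : ℝ} (ha : 0 < a)
    (hXX : ∫ ω, X ω * X ω ∂P = a) (hYY : ∫ ω, Y ω * Y ω ∂P = b) (hXY' : ∫ ω, X ω * Y ω ∂P = c)
    {ε : ℝ} (hε : 0 < ε) :
    ∫ ω, heatKernelDeriv ε (X ω) * heatKernelDeriv ε (Y ω) ∂P =
      c * ((2 * Real.pi)⁻¹ * ((ε + a) * (ε + b) - c ^ 2) ^ (-(3 / 2) : ℝ)) := by
  have hP := hXY.isProbabilityMeasure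
  obtain ⟨K, hK0, hK⟩ := exists_abs_heatKernelDeriv_le ε
  have hc := continuous_heatKernelDeriv ε
  have hint : Integrable (fun ω => heatKernelDeriv ε (X ω) * heatKernelDeriv ε (Y ω)) P := by
    refine Integrable.of_bound (C := K * K) ?_ (ae_of_all _ fun ω => ?_)
    · exact ((hc.measurable.comp_aemeasurable hXY.fst.aemeasurable).mul
        (hc.measurable.comp_aemeasurable hXY.snd.aemeasurable)).aestronglyMeasurable
    · rw [norm_mul]
      exact mul_le_mul (hK _) (hK _) (norm_nonneg _) hK0
  obtain ⟨hv, h⟩ := hXY.integral_mul_comp_eq hX0 hY0 ha hXX hYY hXY' hc hc hint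
  rw [h]
  simp_rw [integral_heatKernelDeriv_add_gaussianReal hε hv]
  rw [integral_heatKernelDeriv_mul_heatKernelDeriv_gaussianReal hε (by positivity) ha]
  have h1 : c / a * a = c := by field_simp
  have h2 : (ε + a) * (ε + (b - c ^ 2 / a)) + (c / a) ^ 2 * (ε * a)
      = (ε + a) * (ε + b) - c ^ 2 := by
    field_simp; ring
  rw [h1, h2]

/-- The conditional mean of `Y` given `X` is `(c / a) X`, so only a one-variable integral remains.
The factor multiplying `-c` is the coefficient of `X` in the first chaos of `-f_ε'(X)`. -/
theorem ProbabilityTheory.HasGaussianLaw.integral_mul_heatKernelDeriv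
    (hXY : HasGaussianLaw (fun ω => (X ω, Y ω)) P)
    (hX0 : ∫ ω, X ω ∂P = 0) (hY0 : ∫ ω, Y ω ∂P = 0) {a b c : ℝ} (ha : 0 < a)
    (hXX : ∫ ω, X ω * X ω ∂P = a) (hYY : ∫ ω, Y ω * Y ω ∂P = b) (hXY' : ∫ ω, X ω * Y ω ∂P = c)
    {ε : ℝ} (hε : 0 < ε) :
    ∫ ω, heatKernelDeriv ε (X ω) * Y ω ∂P =
      -(c * ((√(2 * Real.pi))⁻¹ * (ε + a) ^ (-(3 / 2) : ℝ))) := by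
  have hP := hXY.isProbabilityMeasure
  obtain ⟨K, hK0, hK⟩ := exists_abs_heatKernelDeriv_le ε
  have hc := continuous_heatKernelDeriv ε
  have hint : Integrable (fun ω => heatKernelDeriv ε (X ω) * Y ω) P :=
    hXY.snd.integrable.bdd_mul
      (hc.measurable.comp_aemeasurable hXY.fst.aemeasurable).aestronglyMeasurable
      (ae_of_all _ fun ω => hK _)
  obtain ⟨hv, h⟩ := hXY.integral_mul_comp_eq hX0 hY0 ha hXX hYY hXY' hc continuous_id hint
  simp only [id] at h
  have h2 (v : ℝ≥0) : Integrable (fun w : ℝ => w) (gaussianReal 0 v) :=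
    (memLp_id_gaussianReal 1).integrable le_rfl
  rw [h]
  have h3 : ∀ x, heatKernelDeriv ε x *
      ∫ w, (c / a * x + w) ∂(gaussianReal 0 (b - c ^ 2 / a).toNNReal)
      = c / a * (x * heatKernelDeriv ε x) := by
    intro x
    rw [integral_add (integrable_const _) (h2 _), integral_id_gaussianReal]
    simp only [integral_const, probReal_univ, smul_eq_mul, one_mul]
    ring
  simp_rw [h3]
  rw [integral_const_mul, integral_mul_heatKernelDeriv_gaussianReal hε ha]
  field_simp

end GaussianPair

/-! ### Covariance of increments: representation and local nondeterminism -/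

/-- The difference `(x - z)_+^{1/6} - (y - z)_+^{1/6}` of Mandelbrot–Van Ness kernels. -/
noncomputable def mvnKernel (x y z : ℝ) : ℝ :=
  (max (x - z) 0) ^ (1 / 6 : ℝ) - (max (y - z) 0) ^ (1 / 6 : ℝ)

/-- The covariance of the increments `B_s - B_r` and `B_{s'} - B_{r'}` for the Hurst parameter
`2 / 3`. -/
noncomputable def incrCov (r s r' s' : ℝ) : ℝ :=
  (|s - r'| ^ (4 / 3 : ℝ) + |r - s'| ^ (4 / 3 : ℝ) - |s - s'| ^ (4 / 3 : ℝ)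
    - |r - r'| ^ (4 / 3 : ℝ)) / 2

theorem continuous_mvnKernel (x y : ℝ) : Continuous (mvnKernel x y) := by
  unfold mvnKernel
  refine Continuous.sub ?_ ?_ <;>
  exact Continuous.rpow_const (by fun_prop) fun z => Or.inr (by norm_num)

theorem integrable_sq_mvnKernel_one_zero : Integrable fun z => mvnKernel 1 0 z ^ 2 := by
  have hc : Continuous fun z => mvnKernel 1 0 z ^ 2 := (continuous_mvnKernel 1 0).pow 2
  have h1 : IntegrableOn (fun z => mvnKernel 1 0 z ^ 2) (Set.Ici 1) := by
    refine (integrableOn_zero (s := Set.Ici (1 : ℝ))).congr_fun (fun z hz => ?_) measurableSet_Ici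
    have hz : 1 ≤ z := hz
    simp [mvnKernel, max_eq_right (by linarith : 1 - z ≤ 0), max_eq_right (by linarith : -z ≤ 0)]
  have h2 : IntegrableOn (fun z => mvnKernel 1 0 z ^ 2) (Set.Icc (-1) 1) :=
    hc.continuousOn.integrableOn_Icc
  have h3 : IntegrableOn (fun z => mvnKernel 1 0 (-z) ^ 2) (Set.Ici 1) := by
    have h4 : IntegrableOn (fun z : ℝ => z ^ (-(5 / 3) : ℝ)) (Set.Ici 1) := by
      rw [integrableOn_Ici_iff_integrableOn_Ioi]
      exact integrableOn_Ioi_rpow_of_lt (by norm_num) one_pos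
    refine Integrable.mono' h4 ?_ ?_
    · exact (hc.comp continuous_neg).aestronglyMeasurable
    · filter_upwards [self_mem_ae_restrict measurableSet_Ici] with z hz
      have hz : 1 ≤ z := hz
      have hz0 : 0 < z := by linarith
      have h5 : mvnKernel 1 0 (-z) = (1 + z) ^ (1 / 6 : ℝ) - z ^ (1 / 6 : ℝ) := by
        simp [mvnKernel, max_eq_left (by linarith : 0 ≤ 1 + z), max_eq_left hz0.le]
      have h6 : 0 ≤ mvnKernel 1 0 (-z) := by
        rw [h5, sub_nonneg]
        exact Real.rpow_le_rpow hz0.le (by linarith) (by norm_num)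
      -- Bernoulli's inequality gives decay of order `z^{-5/6}`, whose square is integrable at
      -- infinity.
      have h7 : mvnKernel 1 0 (-z) ≤ z ^ (-(5 / 6) : ℝ) := by
        have h8 : (1 + z) = z * (1 + z⁻¹) := by field_simp; ring
        have h9 : (1 + z⁻¹) ^ (1 / 6 : ℝ) ≤ 1 + z⁻¹ :=
          Real.rpow_le_self_of_one_le (by simp [hz0.le]) (by norm_num)
        have h10 : z ^ (1 / 6 : ℝ) * z⁻¹ = z ^ (-(5 / 6) : ℝ) := by
          rw [← Real.rpow_neg_one z, ← Real.rpow_add hz0]; norm_num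
        rw [h5, h8, Real.mul_rpow hz0.le (by positivity)]
        have := mul_le_mul_of_nonneg_left h9 (by positivity : 0 ≤ z ^ (1 / 6 : ℝ))
        nlinarith
      rw [Real.norm_of_nonneg (sq_nonneg _)]
      calc mvnKernel 1 0 (-z) ^ 2 ≤ (z ^ (-(5 / 6) : ℝ)) ^ 2 := by gcongr
        _ = _ := by rw [← Real.rpow_natCast, ← Real.rpow_mul hz0.le]; norm_num
  have h4 : IntegrableOn (fun z => mvnKernel 1 0 z ^ 2) (Set.Iic (-1)) := by
    have := h3.comp_neg
    simpa using this
  have : (Set.univ : Set ℝ) = Set.Iic (-1) ∪ (Set.Icc (-1) 1 ∪ Set.Ici 1) := by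
    ext z
    simp only [Set.mem_univ, Set.mem_union, Set.mem_Iic, Set.mem_Icc, Set.mem_Ici, true_iff]
    by_cases h : z ≤ -1
    · exact Or.inl h
    · by_cases h' : z ≤ 1
      · exact Or.inr (Or.inl ⟨by linarith, h'⟩)
      · exact Or.inr (Or.inr (by linarith))
  rw [← integrableOn_univ, this]
  exact h4.union (h2.union h1)

theorem mvnKernel_swap (x y z : ℝ) : mvnKernel y x z = -mvnKernel x y z := by
  unfold mvnKernel; ring

theorem mvnKernel_scale {x y : ℝ} (h : y < x) (z : ℝ) :
    mvnKernel x y z = (x - y) ^ (1 / 6 : ℝ) * mvnKernel 1 0 ((x - y)⁻¹ * (z - y)) := by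
  have hd : 0 < x - y := by linarith
  have h1 : max (x - z) 0 = (x - y) * max (1 - (x - y)⁻¹ * (z - y)) 0 := by
    rw [mul_max_of_nonneg _ _ hd.le, mul_zero]; congr 1; field_simp; ring
  have h2 : max (y - z) 0 = (x - y) * max (0 - (x - y)⁻¹ * (z - y)) 0 := by
    rw [mul_max_of_nonneg _ _ hd.le, mul_zero]; congr 1; field_simp; ring
  unfold mvnKernel
  rw [h1, h2, Real.mul_rpow hd.le (le_max_right _ _), Real.mul_rpow hd.le (le_max_right _ _)]
  ring

/-- The normalising constant of the Mandelbrot–Van Ness representation. -/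
noncomputable def mvnConst : ℝ := ∫ z, mvnKernel 1 0 z ^ 2

/-- Scaling and translation of the kernel. Only this deterministic `L²` isometry is used; no
stochastic integral representation of the process is needed. -/
theorem integral_sq_mvnKernel (x y : ℝ) :
    Integrable (fun z => mvnKernel x y z ^ 2) ∧
      ∫ z, mvnKernel x y z ^ 2 = mvnConst * |x - y| ^ (4 / 3 : ℝ) := by
  wlog h : y < x generalizing x y
  · rcases (not_lt.1 h).eq_or_lt with rfl | h'
    · simp [mvnKernel]
    · have := this y x h'
      simp_rw [mvnKernel_swap x y] at this
      rw [abs_sub_comm]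
      simpa using this
  have hd : 0 < x - y := by linarith
  simp_rw [mvnKernel_scale h, mul_pow]
  constructor
  · exact ((integrable_sq_mvnKernel_one_zero.comp_mul_left' (inv_ne_zero hd.ne')).comp_sub_right
      y).const_mul _
  · rw [integral_const_mul,
      integral_sub_right_eq_self (fun z => mvnKernel 1 0 ((x - y)⁻¹ * z) ^ 2) y,
      Measure.integral_comp_mul_left (fun z => mvnKernel 1 0 z ^ 2), inv_inv, abs_of_pos hd,
      smul_eq_mul, mvnConst]
    have : ((x - y) ^ (1 / 6 : ℝ)) ^ 2 * (x - y) = (x - y) ^ (4 / 3 : ℝ) := by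
      rw [← Real.rpow_natCast, ← Real.rpow_mul hd.le]
      nth_rw 2 [← Real.rpow_one (x - y)]
      rw [← Real.rpow_add hd]; norm_num
    rw [← this]; ring

theorem integral_sq_mvnKernel_sub (r s r' s' l : ℝ) :
    Integrable (fun z => (mvnKernel s' r' z - l * mvnKernel s r z) ^ 2) ∧
      ∫ z, (mvnKernel s' r' z - l * mvnKernel s r z) ^ 2 = mvnConst *
        (|s' - r'| ^ (4 / 3 : ℝ) - 2 * l * incrCov r s r' s' + l ^ 2 * |s - r| ^ (4 / 3 : ℝ)) := by
  -- Polarisation: the product of two kernel differences is a combination of squares of single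
  -- differences, whose integrals are known.
  have e : ∀ z, (mvnKernel s' r' z - l * mvnKernel s r z) ^ 2 =
      mvnKernel s' r' z ^ 2 + l ^ 2 * mvnKernel s r z ^ 2
      + (-l) * (mvnKernel s r' z ^ 2 + mvnKernel r s' z ^ 2)
      + l * (mvnKernel s s' z ^ 2 + mvnKernel r r' z ^ 2) := by
    intro z; unfold mvnKernel; ring
  simp_rw [e]
  have i1 := (integral_sq_mvnKernel s' r').1
  have i2 := ((integral_sq_mvnKernel s r).1).const_mul (l ^ 2)
  have i3 := ((integral_sq_mvnKernel s r').1.add (integral_sq_mvnKernel r s').1)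
  have i4 := ((integral_sq_mvnKernel s s').1.add (integral_sq_mvnKernel r r').1)
  have i12 := i1.add i2
  have i123 := i12.add (i3.const_mul (-l))
  refine ⟨i123.add (i4.const_mul l), ?_⟩
  have h1 := integral_add i123 (i4.const_mul l)
  have h2 := integral_add i12 (i3.const_mul (-l))
  have h3 := integral_add i1 i2
  have h4 := integral_add (integral_sq_mvnKernel s r').1 (integral_sq_mvnKernel r s').1
  have h5 := integral_add (integral_sq_mvnKernel s s').1 (integral_sq_mvnKernel r r').1
  simp only [Pi.add_apply, integral_const_mul, (integral_sq_mvnKernel _ _).2] at h1 h2 h3 h4 h5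
  rw [h1, h2, h3, h4, h5, incrCov]
  ring

/-- Restriction to `(m, x]`, where the integrand is `(x - z)^{1/3}`; its integral there is the left
side. -/
theorem le_integral_sq_of_eq_mvnKernel {f : ℝ → ℝ} (hf : Integrable fun z => f z ^ 2) {m x : ℝ}
    (hmx : m ≤ x) (h : ∀ z, m < z → z ≤ x → f z ^ 2 = ((x - z) ^ (1 / 6 : ℝ)) ^ 2) :
    3 / 4 * (x - m) ^ (4 / 3 : ℝ) ≤ ∫ z, f z ^ 2 := by
  have h1 : ∫ z in Set.Ioc m x, f z ^ 2 ≤ ∫ z, f z ^ 2 :=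
    setIntegral_le_integral hf (ae_of_all _ fun z => sq_nonneg _)
  have h2 : ∫ z in Set.Ioc m x, f z ^ 2 = ∫ z in Set.Ioc m x, (x - z) ^ (1 / 3 : ℝ) := by
    refine setIntegral_congr_fun measurableSet_Ioc fun z hz => ?_
    rw [h z hz.1 hz.2, ← Real.rpow_natCast, ← Real.rpow_mul (by linarith [hz.2])]
    norm_num
  rw [h2, ← intervalIntegral.integral_of_le hmx,
    intervalIntegral.integral_comp_sub_left (fun z => z ^ (1 / 3 : ℝ)) x,
    integral_rpow (Or.inl (by norm_num)), sub_self, Real.zero_rpow (by norm_num)] at h1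
  norm_num at h1 ⊢
  linarith

theorem mvnConst_pos : 0 < mvnConst := by
  have h := le_integral_sq_of_eq_mvnKernel integrable_sq_mvnKernel_one_zero zero_le_one
    (fun z hz hz1 => by
      simp [mvnKernel, max_eq_left (by linarith : 0 ≤ 1 - z), max_eq_right (by linarith : -z ≤ 0)])
  rw [← mvnConst] at h
  norm_num at h
  linarith

/-- The constant in the local nondeterminism bounds. -/
noncomputable def lndConst : ℝ := 3 / 4 / mvnConst

theorem lndConst_pos : 0 < lndConst := div_pos (by norm_num) mvnConst_pos

theorem incrCov_swap (r s r' s' : ℝ) : incrCov r' s' r s = incrCov r s r' s' := by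
  unfold incrCov
  rw [abs_sub_comm s' r, abs_sub_comm r' s, abs_sub_comm s' s, abs_sub_comm r' r]
  ring

theorem incrCov_neg (r s r' s' : ℝ) : incrCov (-s) (-r) (-s') (-r') = incrCov r s r' s' := by
  unfold incrCov
  rw [show -r - -s' = -(r - s') by ring, show -s - -r' = -(s - r') by ring,
    show -r - -r' = -(r - r') by ring, show -s - -s' = -(s - s') by ring]
  simp only [abs_neg]
  ring

/-- The determinant is `a` times the residual variance of the second increment after regression on
the first. On `(m, s']` all kernels except that of `s'` vanish, so the regression cannot cancel this
part: the noise after time `m` is new. -/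
theorem det_lower_bound_of_last {r s r' s' m : ℝ} (hrs : r < s) (hs : s ≤ m)
    (hr' : r' ≤ m) (hs' : m ≤ s') :
    lndConst * (|s - r| ^ (4 / 3 : ℝ) * (s' - m) ^ (4 / 3 : ℝ)) ≤
      |s - r| ^ (4 / 3 : ℝ) * |s' - r'| ^ (4 / 3 : ℝ) - incrCov r s r' s' ^ 2 := by
  set a := |s - r| ^ (4 / 3 : ℝ) with ha
  have ha0 : 0 < a := by
    have : 0 < |s - r| := abs_pos.2 (by linarith)
    positivity
  set c := incrCov r s r' s' with hc
  -- The multiplier `c / a` is the regression coefficient of the second increment on the first.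
  obtain ⟨h1, h2⟩ := integral_sq_mvnKernel_sub r s r' s' (c / a)
  have h3 := le_integral_sq_of_eq_mvnKernel h1 hs' (fun z hz hz1 => by
    simp [mvnKernel, max_eq_right (by linarith : s - z ≤ 0), max_eq_right (by linarith : r - z ≤ 0),
      max_eq_left (by linarith : 0 ≤ s' - z), max_eq_right (by linarith : r' - z ≤ 0)])
  rw [h2, ← hc, ← ha] at h3
  have h4 : a * |s' - r'| ^ (4 / 3 : ℝ) - c ^ 2
      = a * (|s' - r'| ^ (4 / 3 : ℝ) - 2 * (c / a) * c + (c / a) ^ 2 * a) := by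
    field_simp; ring
  rw [h4, lndConst]
  have h5 : (3 / 4 / mvnConst) * (a * (s' - m) ^ (4 / 3 : ℝ))
      = a * ((3 / 4 * (s' - m) ^ (4 / 3 : ℝ)) / mvnConst) := by ring
  rw [h5]
  refine mul_le_mul_of_nonneg_left ?_ ha0.le
  rw [div_le_iff₀ mvnConst_pos]
  linarith

/-- Time reversal of `det_lower_bound_of_last`. -/
theorem det_lower_bound_of_first {r s r' s' m : ℝ} (hrs : r < s) (hr : m ≤ r)
    (hr' : r' ≤ m) (hs' : m ≤ s') :
    lndConst * (|s - r| ^ (4 / 3 : ℝ) * (m - r') ^ (4 / 3 : ℝ)) ≤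
      |s - r| ^ (4 / 3 : ℝ) * |s' - r'| ^ (4 / 3 : ℝ) - incrCov r s r' s' ^ 2 := by
  have := det_lower_bound_of_last (r := -s) (s := -r) (r' := -s') (s' := -r') (m := -m)
    (by linarith) (by linarith) (by linarith) (by linarith)
  rw [incrCov_neg, show -r - -s = s - r by ring, show -r' - -s' = s' - r' by ring,
    show -r' - -m = m - r' by ring] at this
  exact this

/-- Either a non-overlapping piece at one end is a fixed fraction of an increment, so the
determinant is comparable to the product of the variances, or both endpoint gaps are small and the
increments have comparable lengths. In the second case the determinant is governed by the larger of
the endpoint gaps. The proof separates disjoint, overlapping and nested intervals. -/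
theorem exists_det_lower_bound {r s r' s' : ℝ} (h : r < s) (h' : r' < s') :
    ∃ D, 0 ≤ D ∧ lndConst * D ^ (4 / 3 : ℝ) ≤
        |s - r| ^ (4 / 3 : ℝ) * |s' - r'| ^ (4 / 3 : ℝ) - incrCov r s r' s' ^ 2 ∧
      ((s - r) * (s' - r') / 8 ≤ D ∨ (s - r ≤ 2 * (s' - r') ∧ s' - r' ≤ 2 * (s - r) ∧
        (s - r) * max |r - r'| |s - s'| / 8 ≤ D ∧ (s' - r') * max |r - r'| |s - s'| / 8 ≤ D)) := by
  wlog hr : r ≤ r' generalizing r s r' s'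
  · obtain ⟨D, hD, h1, h2⟩ := this h' h (not_le.1 hr).le
    refine ⟨D, hD, ?_, ?_⟩
    · rw [incrCov_swap] at h1; linarith
    · rw [abs_sub_comm r, abs_sub_comm s]
      rcases h2 with h2 | ⟨h2, h3, h4, h5⟩
      · left; linarith
      · exact Or.inr ⟨h3, h2, h5, h4⟩
  have last := @det_lower_bound_of_last r s r' s'
  have first' := @det_lower_bound_of_first r' s' r s r' h' le_rfl hr
  have last' := @det_lower_bound_of_last r' s' r s
  simp only [incrCov_swap r s r' s', mul_comm (|s' - r'| ^ (4 / 3 : ℝ)) (|s - r| ^ (4 / 3 : ℝ))]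
    at first' last'
  have hu : 0 < s - r := by linarith
  have hu' : 0 < s' - r' := by linarith
  have e1 : ∀ {x y z w : ℝ}, 0 < x - y → 0 ≤ z - w →
      |x - y| ^ (4 / 3 : ℝ) * (z - w) ^ (4 / 3 : ℝ) = ((x - y) * (z - w)) ^ (4 / 3 : ℝ) := by
    intro x y z w hx hz
    rw [abs_of_pos hx, Real.mul_rpow hx.le hz]
  have hv : 0 ≤ r' - r := by linarith
  rcases le_total s r' with hd | hd
  · refine ⟨(s - r) * (s' - r'), by positivity, ?_, Or.inl (by nlinarith)⟩
    rw [← e1 hu hu'.le]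
    exact last h hd le_rfl h'.le
  have f1 := first' hd
  rw [e1 hu' hv] at f1
  rw [abs_of_nonpos (by linarith : r - r' ≤ 0)]
  rcases le_total s s' with hs | hs
  · have l1 := last h le_rfl hd hs
    rw [e1 hu (by linarith)] at l1
    have hw : 0 ≤ s' - s := by linarith
    rw [abs_of_nonpos (by linarith : s - s' ≤ 0)]
    refine ⟨max ((s - r) * (s' - s)) ((s' - r') * (r' - r)), by positivity, ?_, ?_⟩
    · rcases max_choice ((s - r) * (s' - s)) ((s' - r') * (r' - r)) with hm | hm <;> rw [hm] <;>
        assumption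
    · have hm1 := le_max_left ((s - r) * (s' - s)) ((s' - r') * (r' - r))
      have hm2 := le_max_right ((s - r) * (s' - s)) ((s' - r') * (r' - r))
      set D := max ((s - r) * (s' - s)) ((s' - r') * (r' - r))
      by_cases c1 : (s' - r') ≤ 2 * (s' - s)
      · left; nlinarith
      by_cases c2 : (s - r) ≤ 2 * (r' - r)
      · left; nlinarith
      right
      refine ⟨by linarith, by linarith, ?_, ?_⟩ <;>
      · rcases max_choice (-(r - r')) (-(s - s')) with hm | hm <;> rw [hm] <;> nlinarith
  · have l1 := last' h' le_rfl (by linarith) hs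
    rw [e1 hu' (by linarith)] at l1
    have hw : 0 ≤ s - s' := by linarith
    rw [abs_of_nonneg (by linarith : 0 ≤ s - s')]
    refine ⟨max ((s' - r') * (s - s')) ((s' - r') * (r' - r)), by positivity, ?_, ?_⟩
    · rcases max_choice ((s' - r') * (s - s')) ((s' - r') * (r' - r)) with hm | hm <;> rw [hm] <;>
        assumption
    · have hm1 := le_max_left ((s' - r') * (s - s')) ((s' - r') * (r' - r))
      have hm2 := le_max_right ((s' - r') * (s - s')) ((s' - r') * (r' - r))
      set D := max ((s' - r') * (s - s')) ((s' - r') * (r' - r))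
      -- In the nested case both gaps are cut from the longer interval; if each is below a quarter
      -- of it, the inner interval fills more than half.
      by_cases c1 : (s - r) ≤ 4 * (s - s')
      · left; nlinarith
      by_cases c2 : (s - r) ≤ 4 * (r' - r)
      · left; nlinarith
      right
      refine ⟨by linarith, by linarith, ?_, ?_⟩ <;>
      · rcases max_choice (-(r - r')) (s - s') with hm | hm <;> rw [hm] <;> nlinarith

/-! ### Upper bounds on the covariance of increments and of the higher chaoses. -/

theorem abs_rpow_one_third_sub_le {x u : ℝ} (hx : 0 < x) (hu : 0 < u) :
    |x| ^ (4 / 3 - 2 : ℝ) * x - |x - u| ^ (4 / 3 - 2 : ℝ) * (x - u) ≤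
      2 * u * x ^ (-(2 / 3) : ℝ) := by
  have e : ∀ y : ℝ, 0 < y → |y| ^ (4 / 3 - 2 : ℝ) * y = y ^ (1 / 3 : ℝ) := by
    intro y hy
    nth_rw 2 [← Real.rpow_one y]
    rw [abs_of_pos hy, ← Real.rpow_add hy]; norm_num
  have hx3 : x * x ^ (-(2 / 3) : ℝ) = x ^ (1 / 3 : ℝ) := by
    nth_rw 1 [← Real.rpow_one x]; rw [← Real.rpow_add hx]; norm_num
  have hp : 0 < x ^ (-(2 / 3) : ℝ) := by positivity
  rw [e x hx]
  rcases lt_trichotomy x u with h | rfl | h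
  · have h1 : |x - u| ^ (4 / 3 - 2 : ℝ) * (x - u) = -(u - x) ^ (1 / 3 : ℝ) := by
      rw [← e (u - x) (by linarith), abs_sub_comm]; ring
    have h2 : (u - x) ^ (1 / 3 : ℝ) ≤ u ^ (1 / 3 : ℝ) :=
      Real.rpow_le_rpow (by linarith) (by linarith) (by norm_num)
    have h3 : u ^ (1 / 3 : ℝ) ≤ u * x ^ (-(2 / 3) : ℝ) := by
      have hu3 : u * u ^ (-(2 / 3) : ℝ) = u ^ (1 / 3 : ℝ) := by
        nth_rw 1 [← Real.rpow_one u]; rw [← Real.rpow_add hu]; norm_num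
      rw [← hu3]
      exact mul_le_mul_of_nonneg_left
        (Real.rpow_le_rpow_of_nonpos hx h.le (by norm_num)) hu.le
    rw [h1]
    nlinarith
  · simp only [sub_self, mul_zero, sub_zero]
    nlinarith
  · rw [e (x - u) (by linarith)]
    have h1 : x - u = x * (1 - u / x) := by field_simp
    have hux : u / x ≤ 1 := (div_le_one hx).2 h.le
    have h2 : 1 - u / x ≤ (1 - u / x) ^ (1 / 3 : ℝ) :=
      Real.self_le_rpow_of_le_one (by linarith) (by have : 0 < u / x := by positivity
                                                    linarith) (by norm_num)
    rw [h1, Real.mul_rpow hx.le (by linarith), ← hx3]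
    have h3 : x * x ^ (-(2 / 3) : ℝ) * (1 - u / x) ≤
        x * x ^ (-(2 / 3) : ℝ) * (1 - u / x) ^ (1 / 3 : ℝ) := by gcongr
    have h4 : x * x ^ (-(2 / 3) : ℝ) * (1 - u / x) =
        x * x ^ (-(2 / 3) : ℝ) - u * x ^ (-(2 / 3) : ℝ) := by field_simp
    nlinarith

/-- The covariance is half the increment over `[r', s']` of `y ↦ |y - r|^{4/3} - |y - s|^{4/3}`; the
derivative is controlled by `abs_rpow_one_third_sub_le` and the mean value inequality applies. An
upper bound suffices because negative covariances only help. -/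
theorem incrCov_le_mul {r s r' s' : ℝ} (h : r < s) (h' : r' < s') (hne : r ≠ r') :
    incrCov r s r' s' ≤ 4 / 3 * ((s - r) * (s' - r')) * |r - r'| ^ (-(2 / 3) : ℝ) := by
  wlog hr : r < r' generalizing r s r' s'
  · have := this h' h hne.symm (lt_of_le_of_ne (not_lt.1 hr) hne.symm)
    rw [incrCov_swap, abs_sub_comm] at this
    linarith
  set F : ℝ → ℝ := fun y => |y - r| ^ (4 / 3 : ℝ) - |y - s| ^ (4 / 3 : ℝ) with hF
  have hd : ∀ y, HasDerivAt F
      (4 / 3 * (|y - r| ^ (4 / 3 - 2 : ℝ) * (y - r) - |y - s| ^ (4 / 3 - 2 : ℝ) * (y - s))) y := by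
    intro y
    have h1 := (hasDerivAt_abs_rpow (y - r) (p := 4 / 3) (by norm_num)).comp_sub_const y r
    have h2 := (hasDerivAt_abs_rpow (y - s) (p := 4 / 3) (by norm_num)).comp_sub_const y s
    exact (h1.sub h2).congr_deriv (by ring)
  have hb : ∀ y ∈ Set.Icc r' s', deriv F y ≤ 8 / 3 * (s - r) * (r' - r) ^ (-(2 / 3) : ℝ) := by
    intro y hy
    rw [(hd y).deriv]
    have h1 := abs_rpow_one_third_sub_le (x := y - r) (u := s - r) (by linarith [hy.1])
      (by linarith)
    rw [show y - r - (s - r) = y - s by ring] at h1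
    have h2 : (y - r) ^ (-(2 / 3) : ℝ) ≤ (r' - r) ^ (-(2 / 3) : ℝ) :=
      Real.rpow_le_rpow_of_nonpos (by linarith) (by linarith [hy.1]) (by norm_num)
    have h3 : (s - r) * (y - r) ^ (-(2 / 3) : ℝ) ≤ (s - r) * (r' - r) ^ (-(2 / 3) : ℝ) :=
      mul_le_mul_of_nonneg_left h2 (by linarith)
    linarith
  have hm := (convex_Icc r' s').image_sub_le_mul_sub_of_deriv_le
    (fun y _ => (hd y).continuousAt.continuousWithinAt)
    (fun y _ => (hd y).differentiableAt.differentiableWithinAt)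
    (fun y hy => hb y (interior_subset hy)) r' (Set.left_mem_Icc.2 h'.le) s'
    (Set.right_mem_Icc.2 h'.le) h'.le
  simp only [hF] at hm
  rw [incrCov, abs_sub_comm s r', abs_sub_comm r s', abs_sub_comm s s', abs_sub_comm r r',
    abs_of_pos (by linarith : 0 < r' - r)] at *
  nlinarith

/-- The covariance of the parts of chaos order at least three of `f_ε'(B_s - B_r)` and
`f_ε'(B_{s'} - B_{r'})`. -/
noncomputable def higherChaosCov (ε r s r' s' : ℝ) : ℝ :=
  incrCov r s r' s' * ((2 * Real.pi)⁻¹ *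
    (((ε + |s - r| ^ (4 / 3 : ℝ)) * (ε + |s' - r'| ^ (4 / 3 : ℝ)) - incrCov r s r' s' ^ 2)
        ^ (-(3 / 2) : ℝ) -
      ((ε + |s - r| ^ (4 / 3 : ℝ)) * (ε + |s' - r'| ^ (4 / 3 : ℝ))) ^ (-(3 / 2) : ℝ)))

/-- Bernoulli's inequality for `(D / S)^{3/2}`. Applied with `S - D = c²`, it gains the factor `c² /
S` that removal of the first chaos provides. -/
theorem rpow_neg_three_halves_sub_le {D S : ℝ} (hD : 0 < D) (hDS : D ≤ S) :
    D ^ (-(3 / 2) : ℝ) - S ^ (-(3 / 2) : ℝ) ≤ 3 / 2 * ((S - D) / S) * D ^ (-(3 / 2) : ℝ) := by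
  have hS : 0 < S := by linarith
  have h1 : 1 + (3 / 2 : ℝ) * (D / S - 1) ≤ (1 + (D / S - 1)) ^ (3 / 2 : ℝ) :=
    one_add_mul_self_le_rpow_one_add (by have : 0 < D / S := by positivity
                                         linarith) (by norm_num)
  rw [show 1 + (D / S - 1) = D / S by ring] at h1
  have h2 : (D / S) ^ (3 / 2 : ℝ) * D ^ (-(3 / 2) : ℝ) = S ^ (-(3 / 2) : ℝ) := by
    rw [Real.div_rpow hD.le hS.le, Real.rpow_neg hD.le, Real.rpow_neg hS.le]
    have : 0 < D ^ (3 / 2 : ℝ) := by positivity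
    field_simp
  have h3 : (S - D) / S = 1 - D / S := by field_simp
  have h4 : 0 < D ^ (-(3 / 2) : ℝ) := by positivity
  rw [h3, ← h2]
  linarith [mul_le_mul_of_nonneg_right h1 h4.le]

/-- Interpolation between Cauchy–Schwarz and the decay in `d`. Using the decay bound with power `θ`
leaves, after division by `x^{10/3}`, the exponents `(θ - 4)/3` on `x` and `-2θ/3` on `d`. Both
exceed `-1` exactly when `1 < θ < 3/2`; here `θ = 6/5`. -/
theorem cube_le_of_le_of_le {c x d : ℝ} (hc : 0 ≤ c) (hx : 0 < x) (hd : 0 < d)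
    (h1 : c ≤ x ^ (2 / 3 : ℝ)) (h2 : c ≤ 4 / 3 * x * d ^ (-(2 / 3) : ℝ)) :
    c ^ 3 ≤ (4 / 3) ^ (6 / 5 : ℝ) * x ^ (12 / 5 : ℝ) * d ^ (-(4 / 5) : ℝ) := by
  have e1 : c ^ 3 = c ^ (6 / 5 : ℝ) * c ^ (9 / 5 : ℝ) := by
    rw [← Real.rpow_add' hc (by norm_num), ← Real.rpow_natCast]; norm_num
  have e2 : c ^ (6 / 5 : ℝ) ≤ (4 / 3 * x * d ^ (-(2 / 3) : ℝ)) ^ (6 / 5 : ℝ) :=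
    Real.rpow_le_rpow hc h2 (by norm_num)
  have e3 : c ^ (9 / 5 : ℝ) ≤ (x ^ (2 / 3 : ℝ)) ^ (9 / 5 : ℝ) :=
    Real.rpow_le_rpow hc h1 (by norm_num)
  have e4 : (x ^ (2 / 3 : ℝ)) ^ (9 / 5 : ℝ) = x ^ (6 / 5 : ℝ) := by
    rw [← Real.rpow_mul hx.le]; norm_num
  have e5 : (4 / 3 * x * d ^ (-(2 / 3) : ℝ)) ^ (6 / 5 : ℝ)
      = (4 / 3) ^ (6 / 5 : ℝ) * x ^ (6 / 5 : ℝ) * d ^ (-(4 / 5) : ℝ) := by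
    rw [Real.mul_rpow (by positivity) (by positivity), Real.mul_rpow (by norm_num) hx.le,
      ← Real.rpow_mul hd.le]
    norm_num
  have e6 : x ^ (12 / 5 : ℝ) = x ^ (6 / 5 : ℝ) * x ^ (6 / 5 : ℝ) := by
    rw [← Real.rpow_add hx]; norm_num
  rw [e1, e6]
  calc _ ≤ (4 / 3 * x * d ^ (-(2 / 3) : ℝ)) ^ (6 / 5 : ℝ) * (x ^ (2 / 3 : ℝ)) ^ (9 / 5 : ℝ) :=
        mul_le_mul e2 e3 (by positivity) (by positivity)
    _ = _ := by rw [e4, e5]; ring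

theorem two_pi_inv_le_one : (2 * Real.pi)⁻¹ ≤ 1 :=
  inv_le_one_of_one_le₀ (by linarith [Real.pi_gt_three])

/-- The dominating function for `higherChaosCov` on well separated increments. -/
noncomputable def farBound (r s r' s' : ℝ) : ℝ :=
  ((s - r) * (s' - r')) ^ (-(14 / 15) : ℝ) * |r - r'| ^ (-(4 / 5) : ℝ)

/-- The dominating function for `higherChaosCov` on nearly coinciding increments. -/
noncomputable def closeBound (ε r s r' s' : ℝ) : ℝ :=
  (s - r) ^ (-(2 / 3) : ℝ) *
    (ε + (max |r - r'| |s - s'|) ^ (4 / 3 : ℝ)) ^ (-(3 / 2) : ℝ)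

theorem incrCov_sq_le {r s r' s' : ℝ} (h : r < s) (h' : r' < s') :
    incrCov r s r' s' ^ 2 ≤ |s - r| ^ (4 / 3 : ℝ) * |s' - r'| ^ (4 / 3 : ℝ) := by
  obtain ⟨D, hD, hdet, -⟩ := exists_det_lower_bound h h'
  have : 0 ≤ lndConst * D ^ (4 / 3 : ℝ) := mul_nonneg lndConst_pos.le (by positivity)
  linarith

-- For well separated increments the determinant is comparable to `a b`, and the cancellation
-- between the two powers leaves `c³ (a b)^{-5/2}`, to which the interpolation applies. For nearly
-- coinciding ones no cancellation is used: `c ≤ 2 a`, and the determinant dominates a multiple of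
-- `a (ε + M^{4/3})`.
set_option maxHeartbeats 800000 in
theorem exists_higherChaosCov_le : ∃ K, 0 < K ∧ ∀ ε r s r' s' : ℝ, 0 < ε → r < s → r' < s' →
    r ≠ r' → higherChaosCov ε r s r' s' ≤
      K * farBound r s r' s' + K * closeBound ε r s r' s' := by
  have weaken : ∀ α β x y : ℝ, 0 ≤ α → 0 ≤ β → 0 ≤ x → 0 ≤ y →
      α * x ≤ (α + β) * x + (α + β) * y ∧ β * y ≤ (α + β) * x + (α + β) * y := by
    intro α β x y hα hβ hx hy
    constructor <;>
      linarith [mul_nonneg hα hx, mul_nonneg hα hy, mul_nonneg hβ hx, mul_nonneg hβ hy]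
  have hk := lndConst_pos
  set k1 := lndConst * (1 / 8) ^ (4 / 3 : ℝ) with hk1
  have hk1p : 0 < k1 := by positivity
  set k2 := min 1 k1 with hk2
  have hk2p : 0 < k2 := lt_min one_pos hk1p
  refine ⟨3 / 2 * k1 ^ (-(3 / 2) : ℝ) * (4 / 3) ^ (6 / 5 : ℝ) + 2 * k2 ^ (-(3 / 2) : ℝ),
    by positivity, fun ε r s r' s' hε h h' hne => ?_⟩
  have hu : 0 < s - r := by linarith
  have hu' : 0 < s' - r' := by linarith
  have hd : 0 < |r - r'| := abs_pos.2 (sub_ne_zero.2 hne)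
  have hfar0 : 0 ≤ farBound r s r' s' := by unfold farBound; positivity
  have hclose0 : 0 ≤ closeBound ε r s r' s' := by unfold closeBound; positivity
  obtain ⟨D, hD, hdet, hcase⟩ := exists_det_lower_bound h h'
  have hcs := incrCov_sq_le h h'
  have hcd := incrCov_le_mul h h' hne
  unfold higherChaosCov
  set c := incrCov r s r' s' with hc
  rw [abs_of_pos hu, abs_of_pos hu'] at *
  set u := s - r with hu_def
  set u' := s' - r' with hu'_def
  set a := u ^ (4 / 3 : ℝ) with ha
  set b := u' ^ (4 / 3 : ℝ) with hb
  have ha0 : 0 < a := by positivity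
  have hb0 : 0 < b := by positivity
  clear_value k1 k2 c a b u u'
  have hS : a * b ≤ (ε + a) * (ε + b) := by
    linarith [mul_pos hε hε, mul_pos hε ha0, mul_pos hε hb0]
  set S := (ε + a) * (ε + b) with hSdef
  have hS0 : 0 < S := by positivity
  clear_value S
  -- Of the terms containing `ε`, only `ε a` is kept: it supplies the regularisation in
  -- `closeBound`.
  have hDelta : ε * a + (a * b - c ^ 2) ≤ S - c ^ 2 := by
    rw [hSdef]; linarith [mul_pos hε hε, mul_pos hε hb0]
  have hDelta0 : 0 < S - c ^ 2 := by linarith [mul_pos hε ha0]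
  have hDS : S - c ^ 2 ≤ S := by linarith [sq_nonneg c]
  have hdiff := rpow_neg_three_halves_sub_le hDelta0 hDS
  have hdiff0 : S ^ (-(3 / 2) : ℝ) ≤ (S - c ^ 2) ^ (-(3 / 2) : ℝ) :=
    Real.rpow_le_rpow_of_nonpos hDelta0 hDS (by norm_num)
  have hpi0 : 0 < (2 * Real.pi)⁻¹ := by positivity
  have hpi1 := two_pi_inv_le_one
  -- The bracket is nonnegative, so a nonpositive covariance contributes nothing positive.
  rcases le_or_gt c 0 with hc0 | hc0
  · have : c * ((2 * Real.pi)⁻¹ * ((S - c ^ 2) ^ (-(3 / 2) : ℝ) - S ^ (-(3 / 2) : ℝ))) ≤ 0 :=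
      mul_nonpos_of_nonpos_of_nonneg hc0 (mul_nonneg hpi0.le (by linarith))
    refine this.trans ?_
    positivity
  have hG : c * ((2 * Real.pi)⁻¹ * ((S - c ^ 2) ^ (-(3 / 2) : ℝ) - S ^ (-(3 / 2) : ℝ))) ≤
      c * ((S - c ^ 2) ^ (-(3 / 2) : ℝ) - S ^ (-(3 / 2) : ℝ)) := by
    refine mul_le_mul_of_nonneg_left ?_ hc0.le
    exact mul_le_of_le_one_left (by linarith) hpi1
  refine hG.trans ?_
  have hab : a * b = (u * u') ^ (4 / 3 : ℝ) := by rw [ha, hb, Real.mul_rpow hu.le hu'.le]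
  have hc23 : c ≤ (u * u') ^ (2 / 3 : ℝ) := by
    refine (pow_le_pow_iff_left₀ hc0.le (by positivity) two_ne_zero).1 ?_
    rw [← Real.rpow_natCast ((u * u') ^ (2 / 3 : ℝ)), ← Real.rpow_mul (by positivity)]
    norm_num
    rw [← hab]; exact hcs
  have scale : ∀ y, 0 ≤ y → y / 8 ≤ D → k1 * y ^ (4 / 3 : ℝ) ≤ a * b - c ^ 2 := by
    intro y hy hyD
    refine le_trans ?_ hdet
    rw [hk1, mul_assoc, ← Real.mul_rpow (by norm_num) hy]
    refine mul_le_mul_of_nonneg_left ?_ hk.le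
    exact Real.rpow_le_rpow (by positivity) (by linarith) (by norm_num)
  rcases hcase with hfar | ⟨hc1, hc2, hc3, -⟩
  · have h1 := scale (u * u') (by positivity) hfar
    rw [← hab] at h1
    have h2 : k1 * (a * b) ≤ S - c ^ 2 := by linarith [mul_pos hε ha0]
    have h3 : (S - c ^ 2) ^ (-(3 / 2) : ℝ) ≤ k1 ^ (-(3 / 2) : ℝ) * (a * b) ^ (-(3 / 2) : ℝ) := by
      rw [← Real.mul_rpow hk1p.le (by positivity)]
      exact Real.rpow_le_rpow_of_nonpos (by positivity) h2 (by norm_num)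
    have h4 : (S - (S - c ^ 2)) / S ≤ c ^ 2 / (a * b) := by
      rw [sub_sub_cancel]
      gcongr
    have h5 : c * ((S - c ^ 2) ^ (-(3 / 2) : ℝ) - S ^ (-(3 / 2) : ℝ)) ≤
        c * (3 / 2 * (c ^ 2 / (a * b)) * (k1 ^ (-(3 / 2) : ℝ) * (a * b) ^ (-(3 / 2) : ℝ))) := by
      refine mul_le_mul_of_nonneg_left (hdiff.trans ?_) hc0.le
      gcongr
    have h6 := cube_le_of_le_of_le hc0.le (by positivity : 0 < u * u') hd hc23
      (by linarith)
    have h7 : (u * u') ^ (12 / 5 : ℝ) * ((a * b)⁻¹ * (a * b) ^ (-(3 / 2) : ℝ))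
        = (u * u') ^ (-(14 / 15) : ℝ) := by
      rw [hab, ← Real.rpow_neg (by positivity), ← Real.rpow_mul (by positivity),
        ← Real.rpow_add (by positivity), ← Real.rpow_add (by positivity)]
      norm_num
    calc _ ≤ _ := h5
      _ = 3 / 2 * k1 ^ (-(3 / 2) : ℝ) * ((a * b)⁻¹ * (a * b) ^ (-(3 / 2) : ℝ)) * c ^ 3 := by ring
      _ ≤ 3 / 2 * k1 ^ (-(3 / 2) : ℝ) * ((a * b)⁻¹ * (a * b) ^ (-(3 / 2) : ℝ)) *
          ((4 / 3) ^ (6 / 5 : ℝ) * (u * u') ^ (12 / 5 : ℝ) * |r - r'| ^ (-(4 / 5) : ℝ)) := by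
        gcongr
      _ = 3 / 2 * k1 ^ (-(3 / 2) : ℝ) * (4 / 3) ^ (6 / 5 : ℝ) * farBound r s r' s' := by
        rw [farBound, ← hu_def, ← hu'_def, ← h7]; ring
      _ ≤ _ := (weaken _ _ _ _ (by positivity) (by positivity) hfar0 hclose0).1
  · set M := max |r - r'| |s - s'| with hM
    clear_value M
    have hM0 : 0 ≤ M := hM ▸ le_max_of_le_left (abs_nonneg _)
    have h1 := scale (u * M) (by positivity) hc3
    rw [Real.mul_rpow hu.le hM0, ← ha] at h1
    have h2 : k2 * (a * (ε + M ^ (4 / 3 : ℝ))) ≤ S - c ^ 2 := by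
      have hm1 : k2 ≤ 1 := hk2 ▸ min_le_left _ _
      have hm2 : k2 ≤ k1 := hk2 ▸ min_le_right _ _
      have hMa : 0 ≤ a * M ^ (4 / 3 : ℝ) := by positivity
      linarith [mul_le_mul_of_nonneg_right hm1 (mul_pos hε ha0).le,
        mul_le_mul_of_nonneg_right hm2 hMa]
    have h3 : (S - c ^ 2) ^ (-(3 / 2) : ℝ) ≤
        k2 ^ (-(3 / 2) : ℝ) * (a ^ (-(3 / 2) : ℝ) * (ε + M ^ (4 / 3 : ℝ)) ^ (-(3 / 2) : ℝ)) := by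
      rw [← Real.mul_rpow ha0.le (by positivity), ← Real.mul_rpow hk2p.le (by positivity)]
      exact Real.rpow_le_rpow_of_nonpos (by positivity) h2 (by norm_num)
    have h4 : c ≤ 2 * a := by
      have : (u * u') ^ (2 / 3 : ℝ) ≤ (2 * u ^ 2) ^ (2 / 3 : ℝ) :=
        Real.rpow_le_rpow (by positivity)
          (by linarith [mul_le_mul_of_nonneg_left hc2 hu.le]) (by norm_num)
      have h5 : (2 * u ^ 2) ^ (2 / 3 : ℝ) = 2 ^ (2 / 3 : ℝ) * a := by
        rw [Real.mul_rpow (by norm_num) (by positivity), ha, ← Real.rpow_natCast,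
          ← Real.rpow_mul hu.le]
        norm_num
      have h6 : (2 : ℝ) ^ (2 / 3 : ℝ) ≤ 2 :=
        Real.rpow_le_self_of_one_le (by norm_num) (by norm_num)
      linarith [mul_le_mul_of_nonneg_right h6 ha0.le]
    have h5 : a * a ^ (-(3 / 2) : ℝ) = u ^ (-(2 / 3) : ℝ) := by
      rw [ha, ← Real.rpow_mul hu.le, ← Real.rpow_add hu]; norm_num
    have hS32 : 0 ≤ S ^ (-(3 / 2) : ℝ) := by positivity
    calc c * ((S - c ^ 2) ^ (-(3 / 2) : ℝ) - S ^ (-(3 / 2) : ℝ))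
        ≤ 2 * a * (k2 ^ (-(3 / 2) : ℝ) *
          (a ^ (-(3 / 2) : ℝ) * (ε + M ^ (4 / 3 : ℝ)) ^ (-(3 / 2) : ℝ))) :=
          mul_le_mul h4 (by linarith) (by linarith) (by positivity)
      _ = 2 * k2 ^ (-(3 / 2) : ℝ) * closeBound ε r s r' s' := by
        rw [closeBound, ← hu_def, ← hM, ← h5]; ring
      _ ≤ _ := (weaken _ _ _ _ (by positivity) (by positivity) hfar0 hclose0).2

open scoped ENNReal

/-! ### Integrals of the dominating functions over the simplex -/

/-- The integral `∫_0^t u (ε + u^{4/3})^{-3/2} du`, which carries the logarithmic divergence. -/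
noncomputable def logIntegral (t ε : ℝ) : ℝ :=
  ∫ u in (0 : ℝ)..t, u * (ε + u ^ (4 / 3 : ℝ)) ^ (-(3 / 2) : ℝ)

theorem continuousOn_add_rpow_rpow {ε : ℝ} (hε : 0 < ε) (α : ℝ) :
    ContinuousOn (fun u : ℝ => (ε + u ^ (4 / 3 : ℝ)) ^ α) (Set.Ici 0) := by
  intro u hu
  have hu : 0 ≤ u := hu
  have h1 : ContinuousAt (fun u : ℝ => u ^ (4 / 3 : ℝ)) u :=
    Real.continuousAt_rpow_const _ _ (Or.inr (by norm_num))
  have h2 : 0 < ε + u ^ (4 / 3 : ℝ) := by positivity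
  exact ((continuousAt_const.add h1).rpow_const (Or.inl h2.ne')).continuousWithinAt

theorem intervalIntegrable_logIntegral {t ε : ℝ} (ht : 0 ≤ t) (hε : 0 < ε) :
    IntervalIntegrable (fun u : ℝ => u * (ε + u ^ (4 / 3 : ℝ)) ^ (-(3 / 2) : ℝ)) volume 0 t := by
  refine ContinuousOn.intervalIntegrable (continuousOn_id.mul
    ((continuousOn_add_rpow_rpow hε _).mono ?_))
  rw [Set.uIcc_of_le ht]
  exact Set.Icc_subset_Ici_self

/-- The substitution `y = u^{2/3}` turns the integrand into `(3/2) y² (ε + y²)^{-3/2}`, which has an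
elementary primitive. -/
theorem logIntegral_eq {t ε : ℝ} (ht : 0 ≤ t) (hε : 0 < ε) :
    logIntegral t ε = 3 / 2 * (Real.arsinh (t ^ (2 / 3 : ℝ) / √ε)
      - t ^ (2 / 3 : ℝ) / √(ε + (t ^ (2 / 3 : ℝ)) ^ 2)) := by
  have hs : 0 < √ε := Real.sqrt_pos.2 hε
  have hcont : Continuous fun y : ℝ =>
      3 / 2 * (Real.arsinh (y / √ε) - y / √(ε + y ^ 2)) := by
    refine continuous_const.mul ((Real.continuous_arsinh.comp (by fun_prop)).sub
      (Continuous.div continuous_id (by fun_prop) fun y => ?_))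
    have : 0 < ε + y ^ 2 := by positivity
    exact (Real.sqrt_pos.2 this).ne'
  have hder : ∀ y : ℝ, HasDerivAt (fun y : ℝ =>
      3 / 2 * (Real.arsinh (y / √ε) - y / √(ε + y ^ 2)))
      (3 / 2 * (y ^ 2 * (ε + y ^ 2) ^ (-(3 / 2) : ℝ))) y := by
    intro y
    have hp : 0 < ε + y ^ 2 := by positivity
    have hq : 0 < √(ε + y ^ 2) := Real.sqrt_pos.2 hp
    have h1 := ((hasDerivAt_id y).div_const (√ε)).arsinh
    have h2 : HasDerivAt (fun y : ℝ => ε + y ^ 2) (2 * y) y := by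
      simpa using (hasDerivAt_pow 2 y).const_add ε
    have h3 := (hasDerivAt_id y).div (h2.sqrt hp.ne') hq.ne'
    refine ((h1.sub h3).const_mul (3 / 2)).congr_deriv ?_
    have e1 : √(1 + (y / √ε) ^ 2) = √(ε + y ^ 2) / √ε := by
      rw [← Real.sqrt_div hp.le]
      congr 1
      rw [div_pow, Real.sq_sqrt hε.le]
      field_simp
    have e2 : √(ε + y ^ 2) ^ 2 = ε + y ^ 2 := Real.sq_sqrt hp.le
    simp only [id]
    rw [e1, ← inv_mul_inv_sqrt_eq_rpow hp, smul_eq_mul]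
    generalize √(ε + y ^ 2) = q at *
    rw [← e2]
    have e3 : (q / √ε)⁻¹ * (1 / √ε) = 1 / q := by field_simp
    rw [e3]
    field_simp
    ring
  have h0 : (0 : ℝ) ^ (2 / 3 : ℝ) = 0 := Real.zero_rpow (by norm_num)
  have hrp : Continuous fun u : ℝ => u ^ (2 / 3 : ℝ) :=
    Real.continuous_rpow_const (by norm_num)
  rw [logIntegral, intervalIntegral.integral_eq_sub_of_hasDerivAt_of_le
    (f := fun u : ℝ => 3 / 2 * (Real.arsinh (u ^ (2 / 3 : ℝ) / √ε)
      - u ^ (2 / 3 : ℝ) / √(ε + (u ^ (2 / 3 : ℝ)) ^ 2))) ht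
    (hcont.comp hrp).continuousOn ?_ (intervalIntegrable_logIntegral ht hε)]
  · simp [h0]
  · intro u hu
    have hu0 : 0 < u := hu.1
    have h1 := Real.hasDerivAt_rpow_const (x := u) (p := 2 / 3) (Or.inl hu0.ne')
    refine ((hder (u ^ (2 / 3 : ℝ))).comp u h1).congr_deriv ?_
    have e1 : (u ^ (2 / 3 : ℝ)) ^ 2 = u ^ (4 / 3 : ℝ) := by
      rw [← Real.rpow_natCast, ← Real.rpow_mul hu0.le]; norm_num
    have e2 : u ^ (4 / 3 : ℝ) * u ^ (2 / 3 - 1 : ℝ) = u := by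
      rw [← Real.rpow_add hu0]; norm_num
    rw [e1]
    calc _ = (u ^ (4 / 3 : ℝ) * u ^ (2 / 3 - 1 : ℝ)) *
          (ε + u ^ (4 / 3 : ℝ)) ^ (-(3 / 2) : ℝ) := by ring
      _ = _ := by rw [e2]

theorem tendsto_logIntegral {t : ℝ} (ht : 0 < t) :
    Tendsto (fun ε => (Real.log (1 / ε))⁻¹ * logIntegral t ε) (𝓝[>] 0) (𝓝 (3 / 4)) := by
  set T := t ^ (2 / 3 : ℝ) with hT
  have hT0 : 0 < T := by positivity
  have hlog : Tendsto (fun ε : ℝ => Real.log (1 / ε)) (𝓝[>] 0) atTop := by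
    simp_rw [one_div, Real.log_inv]
    exact tendsto_neg_atBot_atTop.comp Real.tendsto_log_nhdsGT_zero
  have hinv := tendsto_inv_atTop_zero.comp hlog
  set g : ℝ → ℝ := fun ε => 3 / 2 * (Real.log (T + √(ε + T ^ 2)) - T / √(ε + T ^ 2)) with hg
  have hgc : ContinuousAt g 0 := by
    have h1 : 0 < √(0 + T ^ 2) := Real.sqrt_pos.2 (by positivity)
    refine continuousAt_const.mul (ContinuousAt.sub (ContinuousAt.log (by fun_prop) ?_)
      (ContinuousAt.div (by fun_prop) (by fun_prop) h1.ne'))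
    positivity
  have hgt : Tendsto g (𝓝[>] 0) (𝓝 (g 0)) := hgc.tendsto.mono_left nhdsWithin_le_nhds
  have hlim := (hinv.mul hgt).const_add (3 / 4)
  rw [zero_mul, add_zero] at hlim
  refine hlim.congr' ?_
  filter_upwards [self_mem_nhdsWithin, hlog.eventually_gt_atTop 0] with ε hε hL
  have hε : 0 < ε := hε
  have hs : 0 < √ε := Real.sqrt_pos.2 hε
  -- This isolates the divergence: `(1/2) log(1/ε)`, times the prefactor `3/2`, gives the limit
  -- `3/4`; the rest converges.
  have e1 : Real.arsinh (T / √ε) = Real.log (T + √(ε + T ^ 2)) + 1 / 2 * Real.log (1 / ε) := by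
    have h1 : √(1 + (T / √ε) ^ 2) = √(ε + T ^ 2) / √ε := by
      rw [← Real.sqrt_div (by positivity)]
      congr 1
      rw [div_pow, Real.sq_sqrt hε.le]
      field_simp
    have h2 : Real.log (1 / ε) = -Real.log ε := by rw [one_div, Real.log_inv]
    rw [Real.arsinh, h1, ← add_div, Real.log_div (by positivity) hs.ne', Real.log_sqrt hε.le, h2]
    ring
  rw [logIntegral_eq ht.le hε, ← hT, e1]
  simp only [Function.comp_apply, hg]
  field_simp
  ring

theorem lintegral_prod_shear {f g : ℝ → ℝ≥0∞} (hf : Measurable f) (hg : Measurable g) :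
    ∫⁻ p : ℝ × ℝ, f p.1 * g (p.2 - p.1) = (∫⁻ x, f x) * ∫⁻ x, g x := by
  rw [Measure.volume_eq_prod, lintegral_prod _ (by fun_prop)]
  have : ∀ x, ∫⁻ y, f x * g (y - x) = f x * ∫⁻ y, g y := by
    intro x
    rw [lintegral_const_mul _ (by fun_prop), lintegral_sub_right_eq_self]
  simp_rw [this]
  exact lintegral_mul_const _ hf

theorem lintegral_Ioo_abs_le {φ : ℝ → ℝ≥0∞} (hφ : Measurable φ) (t : ℝ) :
    ∫⁻ x, (Set.Ioo (-t) t).indicator (fun x => φ |x|) x ≤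
      2 * ∫⁻ x, (Set.Ioo 0 t).indicator φ x := by
  have hF : Measurable ((Set.Ioo 0 t).indicator φ) := hφ.indicator measurableSet_Ioo
  have h1 : ∫⁻ x, (Set.Ioo 0 t).indicator φ (-x) = ∫⁻ x, (Set.Ioo 0 t).indicator φ x :=
    lintegral_neg_eq_self ((Set.Ioo 0 t).indicator φ)
  rw [two_mul]
  nth_rw 2 [← h1]
  rw [← lintegral_add_left hF]
  refine lintegral_mono_ae ?_
  filter_upwards [Measure.ae_ne volume (0 : ℝ)] with x hx
  by_cases hm : x ∈ Set.Ioo (-t) t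
  · rw [Set.indicator_of_mem hm]
    rcases lt_or_gt_of_ne hx with h | h
    · rw [abs_of_neg h]
      refine le_add_left ?_
      rw [Set.indicator_of_mem (show -x ∈ Set.Ioo 0 t from ⟨by linarith, by linarith [hm.1]⟩)]
    · rw [abs_of_pos h]
      refine le_add_right ?_
      rw [Set.indicator_of_mem (show x ∈ Set.Ioo 0 t from ⟨h, hm.2⟩)]
  · rw [Set.indicator_of_notMem hm]
    exact zero_le

theorem lintegral_Ioo_rpow_lt_top {α : ℝ} (hα : -1 < α) (t : ℝ) :
    ∫⁻ x, (Set.Ioo 0 t).indicator (fun x => ENNReal.ofReal (x ^ α)) x < ∞ := by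
  rw [lintegral_indicator measurableSet_Ioo]
  rcases le_or_gt t 0 with ht | ht
  · simp [Set.Ioo_eq_empty (not_lt.2 ht)]
  have h := (intervalIntegral.intervalIntegrable_rpow' (a := 0) (b := t) hα).1
  have h2 : IntegrableOn (fun x : ℝ => x ^ α) (Set.Ioo 0 t) := h.mono_set Set.Ioo_subset_Ioc_self
  have h3 := h2.2
  rw [hasFiniteIntegral_iff_norm] at h3
  refine lt_of_le_of_lt (lintegral_mono fun x => ?_) h3
  exact ENNReal.ofReal_le_ofReal (le_abs_self _)

theorem measurableSet_timeSimplex (t : ℝ) : MeasurableSet (timeSimplex t) := by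
  unfold timeSimplex
  refine (measurableSet_lt measurable_const measurable_fst).inter
    ((measurableSet_lt measurable_fst measurable_snd).inter
      (measurableSet_lt measurable_snd measurable_const))

theorem setLIntegral_timeSimplex_rpow_lt_top {α : ℝ} (hα : -1 < α) (t : ℝ) :
    ∫⁻ p in timeSimplex t, ENNReal.ofReal ((p.2 - p.1) ^ α) < ∞ := by
  set h := (Set.Ioo 0 t).indicator (fun x : ℝ => ENNReal.ofReal (x ^ α)) with hh
  set o := (Set.Ioo 0 t).indicator (fun _ : ℝ => (1 : ℝ≥0∞)) with ho
  have hm : Measurable h := (by fun_prop : Measurable fun x : ℝ => ENNReal.ofReal (x ^ α)).indicator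
    measurableSet_Ioo
  have om : Measurable o := measurable_const.indicator measurableSet_Ioo
  have h1 : ∫⁻ p in timeSimplex t, ENNReal.ofReal ((p.2 - p.1) ^ α) ≤
      ∫⁻ p : ℝ × ℝ, o p.1 * h (p.2 - p.1) := by
    refine (setLIntegral_mono' (measurableSet_timeSimplex t) fun p hp => ?_).trans
      (setLIntegral_le_lintegral _ _)
    obtain ⟨h1, h2, h3⟩ := hp
    rw [ho, hh, Set.indicator_of_mem (show p.1 ∈ Set.Ioo 0 t from ⟨h1, h2.trans h3⟩),
      Set.indicator_of_mem (show p.2 - p.1 ∈ Set.Ioo 0 t from ⟨by linarith, by linarith⟩), one_mul]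
  refine h1.trans_lt ?_
  rw [lintegral_prod_shear om hm]
  refine ENNReal.mul_lt_top ?_ (lintegral_Ioo_rpow_lt_top hα t)
  rw [ho, lintegral_indicator measurableSet_Ioo]
  simp

/-- After passing to the length and the starting point of each increment, the exponents `-14/15` and
`-4/5` are all integrable at zero. -/
theorem exists_setLIntegral_farBound_le (t : ℝ) : ∃ C : ℝ≥0∞, C ≠ ∞ ∧
    ∫⁻ p in timeSimplex t, ∫⁻ q in timeSimplex t,
      ENNReal.ofReal (farBound p.1 p.2 q.1 q.2) ≤ C := by
  set m := (Set.Ioo (-t) t).indicator (fun x : ℝ => ENNReal.ofReal (|x| ^ (-(4 / 5) : ℝ))) with hm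
  set h := (Set.Ioo 0 t).indicator (fun x : ℝ => ENNReal.ofReal (x ^ (-(14 / 15) : ℝ))) with hh
  have mm : Measurable m :=
    (by fun_prop : Measurable fun x : ℝ => ENNReal.ofReal (|x| ^ (-(4 / 5) : ℝ))).indicator
      measurableSet_Ioo
  have mh : Measurable h :=
    (by fun_prop : Measurable fun x : ℝ => ENNReal.ofReal (x ^ (-(14 / 15) : ℝ))).indicator
      measurableSet_Ioo
  have fm : ∫⁻ x, m x < ∞ := by
    refine (lintegral_Ioo_abs_le (φ := fun x => ENNReal.ofReal (x ^ (-(4 / 5) : ℝ)))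
      (by fun_prop) t).trans_lt ?_
    exact ENNReal.mul_lt_top (by simp) (lintegral_Ioo_rpow_lt_top (by norm_num) t)
  have fh : ∫⁻ x, h x < ∞ := lintegral_Ioo_rpow_lt_top (by norm_num) t
  have hp : ∀ p ∈ timeSimplex t, ∫⁻ q in timeSimplex t,
      ENNReal.ofReal (farBound p.1 p.2 q.1 q.2) ≤
      ENNReal.ofReal ((p.2 - p.1) ^ (-(14 / 15) : ℝ)) * ((∫⁻ x, m x) * ∫⁻ x, h x) := by
    intro p hp
    obtain ⟨p1, p2, p3⟩ := hp
    have e1 : (∫⁻ x, m x) = ∫⁻ x, m (p.1 - x) := (lintegral_sub_left_eq_self m p.1).symm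
    rw [e1, ← lintegral_prod_shear (by fun_prop) mh, ← lintegral_const_mul _ (by fun_prop)]
    refine (setLIntegral_mono' (measurableSet_timeSimplex t) fun q hq => ?_).trans
      (setLIntegral_le_lintegral _ _)
    obtain ⟨q1, q2, q3⟩ := hq
    rw [hm, hh, Set.indicator_of_mem (show p.1 - q.1 ∈ Set.Ioo (-t) t from
        ⟨by linarith, by linarith⟩),
      Set.indicator_of_mem (show q.2 - q.1 ∈ Set.Ioo 0 t from ⟨by linarith, by linarith⟩),
      farBound, Real.mul_rpow (by linarith) (by linarith), ENNReal.ofReal_mul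
        (mul_nonneg (Real.rpow_nonneg (by linarith) _) (Real.rpow_nonneg (by linarith) _)),
      ENNReal.ofReal_mul (Real.rpow_nonneg (by linarith) _), mul_assoc]
    exact mul_le_mul_right (mul_comm _ _).le _
  refine ⟨(∫⁻ p in timeSimplex t, ENNReal.ofReal ((p.2 - p.1) ^ (-(14 / 15) : ℝ))) *
    ((∫⁻ x, m x) * ∫⁻ x, h x), (ENNReal.mul_lt_top
      (setLIntegral_timeSimplex_rpow_lt_top (by norm_num) t) (ENNReal.mul_lt_top fm fh)).ne, ?_⟩
  rw [← lintegral_mul_const _ (by fun_prop)]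
  exact setLIntegral_mono' (measurableSet_timeSimplex t) hp

/-- Polar coordinates for the maximum norm. The factor `8` comes from two choices of the larger
coordinate, two signs for it, and the length `2|x|` of the fibre of the other. -/
theorem lintegral_max_le {φ : ℝ → ℝ≥0∞} (hφ : Measurable φ) (t : ℝ) :
    ∫⁻ z : ℝ × ℝ, (Set.Ioo (-t) t ×ˢ Set.Ioo (-t) t).indicator (fun z => φ (max |z.1| |z.2|)) z ≤
      8 * ∫⁻ x, (Set.Ioo 0 t).indicator (fun x => φ x * ENNReal.ofReal x) x := by
  set F : ℝ → ℝ≥0∞ := (Set.Ioo (-t) t).indicator (fun x => φ |x|) with hF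
  have mF : Measurable F := (by fun_prop : Measurable fun x : ℝ => φ |x|).indicator
    measurableSet_Ioo
  set G : ℝ × ℝ → ℝ≥0∞ := fun z => F z.1 * (Set.Icc (-|z.1|) |z.1|).indicator 1 z.2 with hG
  have mG : Measurable G := by
    refine (mF.comp measurable_fst).mul ?_
    have : (fun z : ℝ × ℝ => (Set.Icc (-|z.1|) |z.1|).indicator (1 : ℝ → ℝ≥0∞) z.2) =
        ({z : ℝ × ℝ | -|z.1| ≤ z.2} ∩ {z | z.2 ≤ |z.1|}).indicator 1 := by
      ext z
      simp only [Set.indicator, Set.mem_Icc, Set.mem_inter_iff, Set.mem_ofPred_eq, Pi.one_apply]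
    rw [this]
    exact measurable_one.indicator ((measurableSet_le (by fun_prop) (by fun_prop)).inter
      (measurableSet_le (by fun_prop) (by fun_prop)))
  have hGint : ∫⁻ z, G z ≤
      4 * ∫⁻ x, (Set.Ioo 0 t).indicator (fun x => φ x * ENNReal.ofReal x) x := by
    rw [Measure.volume_eq_prod, lintegral_prod _ mG.aemeasurable]
    have h1 : ∀ x, ∫⁻ y, G (x, y) =
        2 * (Set.Ioo (-t) t).indicator (fun x => φ |x| * ENNReal.ofReal |x|) x := by
      intro x
      simp only [hG]
      rw [lintegral_const_mul _ (measurable_one.indicator measurableSet_Icc),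
        lintegral_indicator_one measurableSet_Icc, Real.volume_Icc, hF]
      have : |x| - -|x| = 2 * |x| := by ring
      rw [this, ENNReal.ofReal_mul (by norm_num)]
      by_cases hx : x ∈ Set.Ioo (-t) t
      · rw [Set.indicator_of_mem hx, Set.indicator_of_mem hx]; simp; ring
      · rw [Set.indicator_of_notMem hx, Set.indicator_of_notMem hx]; simp
    simp_rw [h1]
    rw [lintegral_const_mul _ ((by fun_prop :
      Measurable fun x : ℝ => φ |x| * ENNReal.ofReal |x|).indicator measurableSet_Ioo)]
    refine (mul_le_mul_right (lintegral_Ioo_abs_le (φ := fun x => φ x * ENNReal.ofReal x)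
      (by fun_prop) t) 2).trans ?_
    rw [← mul_assoc]; norm_num
  have hswap : ∫⁻ z : ℝ × ℝ, G z.swap = ∫⁻ z, G z := by
    rw [Measure.volume_eq_prod]
    exact lintegral_prod_swap G
  have hle : ∀ z : ℝ × ℝ, (Set.Ioo (-t) t ×ˢ Set.Ioo (-t) t).indicator
      (fun z => φ (max |z.1| |z.2|)) z ≤ G z + G z.swap := by
    intro z
    by_cases hz : z ∈ Set.Ioo (-t) t ×ˢ Set.Ioo (-t) t
    · rw [Set.indicator_of_mem hz]
      rcases le_total |z.2| |z.1| with h | h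
      · refine le_add_right ?_
        simp only [hG, hF]
        rw [Set.indicator_of_mem hz.1, Set.indicator_of_mem (Set.mem_Icc.2 (abs_le.1 h)),
          max_eq_left h]
        simp
      · refine le_add_left ?_
        simp only [hG, hF, Prod.fst_swap, Prod.snd_swap]
        rw [Set.indicator_of_mem hz.2, Set.indicator_of_mem (Set.mem_Icc.2 (abs_le.1 h)),
          max_eq_right h]
        simp
    · rw [Set.indicator_of_notMem hz]; exact zero_le
  calc _ ≤ ∫⁻ z, (G z + G z.swap) := lintegral_mono hle
    _ = 2 * ∫⁻ z, G z := by rw [lintegral_add_left mG, hswap, two_mul]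
    _ ≤ 2 * (4 * _) := mul_le_mul_right hGint 2
    _ = _ := by rw [← mul_assoc]; norm_num

theorem ofReal_logIntegral {t ε : ℝ} (ht : 0 ≤ t) (hε : 0 < ε) :
    ∫⁻ x, (Set.Ioo 0 t).indicator (fun x =>
      ENNReal.ofReal ((ε + x ^ (4 / 3 : ℝ)) ^ (-(3 / 2) : ℝ)) * ENNReal.ofReal x) x =
    ENNReal.ofReal (logIntegral t ε) := by
  rw [logIntegral, intervalIntegral.integral_of_le ht, integral_Ioc_eq_integral_Ioo,
    ofReal_integral_eq_lintegral_ofReal, lintegral_indicator measurableSet_Ioo]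
  · refine setLIntegral_congr_fun measurableSet_Ioo fun x hx => ?_
    have : 0 < x := hx.1
    rw [ENNReal.ofReal_mul this.le, mul_comm]
  · exact (intervalIntegrable_logIntegral ht hε).1.mono_set Set.Ioo_subset_Ioc_self
  · filter_upwards [self_mem_ae_restrict measurableSet_Ioo] with x hx
    have : 0 < x := hx.1
    simp only [Pi.zero_apply]
    positivity

/-- For a fixed first increment the bound depends on the second only through the maximum norm of `p
- q`, so the two-dimensional integral reduces to `logIntegral`. -/
theorem exists_setLIntegral_closeBound_le {t : ℝ} (ht : 0 ≤ t) : ∃ C : ℝ≥0∞, C ≠ ∞ ∧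
    ∀ ε, 0 < ε → ∫⁻ p in timeSimplex t, ∫⁻ q in timeSimplex t,
      ENNReal.ofReal (closeBound ε p.1 p.2 q.1 q.2) ≤ C * ENNReal.ofReal (logIntegral t ε) := by
  refine ⟨(∫⁻ p in timeSimplex t, ENNReal.ofReal ((p.2 - p.1) ^ (-(2 / 3) : ℝ))) * 8,
    (ENNReal.mul_lt_top (setLIntegral_timeSimplex_rpow_lt_top (by norm_num) t) (by simp)).ne,
    fun ε hε => ?_⟩
  set φ : ℝ → ℝ≥0∞ := fun x => ENNReal.ofReal ((ε + x ^ (4 / 3 : ℝ)) ^ (-(3 / 2) : ℝ)) with hφ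
  have mφ : Measurable φ := by fun_prop
  set Ψ : ℝ × ℝ → ℝ≥0∞ := (Set.Ioo (-t) t ×ˢ Set.Ioo (-t) t).indicator
    (fun z => φ (max |z.1| |z.2|)) with hΨ
  have mΨ : Measurable Ψ :=
    (by fun_prop : Measurable fun z : ℝ × ℝ => φ (max |z.1| |z.2|)).indicator
    (measurableSet_Ioo.prod measurableSet_Ioo)
  have hΨint : ∫⁻ z, Ψ z ≤ 8 * ENNReal.ofReal (logIntegral t ε) := by
    rw [← ofReal_logIntegral ht hε]
    exact lintegral_max_le mφ t
  have hp : ∀ p ∈ timeSimplex t, ∫⁻ q in timeSimplex t,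
      ENNReal.ofReal (closeBound ε p.1 p.2 q.1 q.2) ≤
      ENNReal.ofReal ((p.2 - p.1) ^ (-(2 / 3) : ℝ)) * (8 * ENNReal.ofReal (logIntegral t ε)) := by
    intro p hp
    obtain ⟨p1, p2, p3⟩ := hp
    refine le_trans ?_ (mul_le_mul_right hΨint _)
    rw [← lintegral_sub_left_eq_self Ψ p, ← lintegral_const_mul _ (by fun_prop)]
    refine (setLIntegral_mono' (measurableSet_timeSimplex t) fun q hq => ?_).trans
      (setLIntegral_le_lintegral _ _)
    obtain ⟨q1, q2, q3⟩ := hq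
    rw [hΨ, Set.indicator_of_mem (show p - q ∈ Set.Ioo (-t) t ×ˢ Set.Ioo (-t) t from
      ⟨⟨by simp only [Prod.fst_sub]; linarith, by simp only [Prod.fst_sub]; linarith⟩,
       ⟨by simp only [Prod.snd_sub]; linarith, by simp only [Prod.snd_sub]; linarith⟩⟩),
      closeBound, ENNReal.ofReal_mul (Real.rpow_nonneg (by linarith) _)]
    rfl
  rw [mul_assoc, ← lintegral_mul_const _ (by fun_prop)]
  exact setLIntegral_mono' (measurableSet_timeSimplex t) hp

theorem measurable_farBound : Measurable fun z : (ℝ × ℝ) × (ℝ × ℝ) =>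
    ENNReal.ofReal (farBound z.1.1 z.1.2 z.2.1 z.2.2) := by
  unfold farBound; fun_prop

theorem measurable_closeBound (ε : ℝ) : Measurable fun z : (ℝ × ℝ) × (ℝ × ℝ) =>
    ENNReal.ofReal (closeBound ε z.1.1 z.1.2 z.2.1 z.2.2) := by
  unfold closeBound; fun_prop

theorem farBound_nonneg {r s r' s' : ℝ} (h : r < s) (h' : r' < s') : 0 ≤ farBound r s r' s' := by
  have h1 : 0 < s - r := by linarith
  have h2 : 0 < s' - r' := by linarith
  unfold farBound; positivity

theorem closeBound_nonneg {ε r s r' s' : ℝ} (hε : 0 < ε) (h : r < s) :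
    0 ≤ closeBound ε r s r' s' := by
  have h1 : 0 < s - r := by linarith
  unfold closeBound; positivity

theorem logIntegral_nonneg {t ε : ℝ} (ht : 0 ≤ t) (hε : 0 < ε) : 0 ≤ logIntegral t ε := by
  refine intervalIntegral.integral_nonneg ht fun u hu => ?_
  have := hu.1
  positivity

theorem exists_setLIntegral_higherChaosCov_le {t : ℝ} (ht : 0 ≤ t) : ∃ C : ℝ, 0 ≤ C ∧
    ∀ ε, 0 < ε → ∫⁻ p in timeSimplex t, ∫⁻ q in timeSimplex t,
      ENNReal.ofReal (higherChaosCov ε p.1 p.2 q.1 q.2) ≤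
        ENNReal.ofReal (C * (1 + logIntegral t ε)) := by
  obtain ⟨K, hK, hb⟩ := exists_higherChaosCov_le
  obtain ⟨C1, hC1, h1⟩ := exists_setLIntegral_farBound_le t
  obtain ⟨C2, hC2, h2⟩ := exists_setLIntegral_closeBound_le ht
  refine ⟨K * (C1 + C2).toReal, mul_nonneg hK.le ENNReal.toReal_nonneg, fun ε hε => ?_⟩
  have hJ := logIntegral_nonneg ht hε
  have mfar := measurable_farBound
  have mclose := measurable_closeBound ε
  have mfar' (p : ℝ × ℝ) : Measurable fun q : ℝ × ℝ =>
      ENNReal.ofReal (farBound p.1 p.2 q.1 q.2) := by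
    unfold farBound; fun_prop
  have mclose' (p : ℝ × ℝ) : Measurable fun q : ℝ × ℝ =>
      ENNReal.ofReal (closeBound ε p.1 p.2 q.1 q.2) := by
    unfold closeBound; fun_prop
  have step : ∀ p ∈ timeSimplex t, ∫⁻ q in timeSimplex t,
      ENNReal.ofReal (higherChaosCov ε p.1 p.2 q.1 q.2) ≤
      ENNReal.ofReal K * ((∫⁻ q in timeSimplex t, ENNReal.ofReal (farBound p.1 p.2 q.1 q.2)) +
        ∫⁻ q in timeSimplex t, ENNReal.ofReal (closeBound ε p.1 p.2 q.1 q.2)) := by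
    intro p hp
    have hs : Measurable fun q : ℝ × ℝ => ENNReal.ofReal (farBound p.1 p.2 q.1 q.2) +
        ENNReal.ofReal (closeBound ε p.1 p.2 q.1 q.2) := (mfar' p).add (mclose' p)
    rw [← lintegral_add_left (mfar' p), ← lintegral_const_mul _ hs]
    -- The pointwise bound excludes equal starting points, which form a null set.
    have hne : ∀ᵐ q : ℝ × ℝ, q.1 ≠ p.1 :=
      (Measure.quasiMeasurePreserving_fst (μ := (volume : Measure ℝ))
        (ν := (volume : Measure ℝ))).ae (Measure.ae_ne volume p.1)
    refine setLIntegral_mono_ae (hs.const_mul _).aemeasurable ?_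
    filter_upwards [hne] with q hq hqD
    rw [← ENNReal.ofReal_add (farBound_nonneg hp.2.1 hqD.2.1) (closeBound_nonneg hε hp.2.1),
      ← ENNReal.ofReal_mul hK.le]
    refine ENNReal.ofReal_le_ofReal ?_
    rw [mul_add]
    exact hb ε _ _ _ _ hε hp.2.1 hqD.2.1 hq.symm
  have m1 : Measurable fun p : ℝ × ℝ => ∫⁻ q in timeSimplex t,
      ENNReal.ofReal (farBound p.1 p.2 q.1 q.2) := mfar.lintegral_prod_right'
  have m2 : Measurable fun p : ℝ × ℝ => ∫⁻ q in timeSimplex t,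
      ENNReal.ofReal (closeBound ε p.1 p.2 q.1 q.2) := mclose.lintegral_prod_right'
  calc _ ≤ _ := setLIntegral_mono' (measurableSet_timeSimplex t) step
    _ = ENNReal.ofReal K * ((∫⁻ p in timeSimplex t, ∫⁻ q in timeSimplex t,
          ENNReal.ofReal (farBound p.1 p.2 q.1 q.2)) + ∫⁻ p in timeSimplex t,
          ∫⁻ q in timeSimplex t, ENNReal.ofReal (closeBound ε p.1 p.2 q.1 q.2)) := by
      have m12 : Measurable fun p : ℝ × ℝ =>
          (∫⁻ q in timeSimplex t, ENNReal.ofReal (farBound p.1 p.2 q.1 q.2)) +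
            ∫⁻ q in timeSimplex t, ENNReal.ofReal (closeBound ε p.1 p.2 q.1 q.2) := m1.add m2
      rw [lintegral_const_mul _ m12, lintegral_add_left m1]
    _ ≤ ENNReal.ofReal K * (C1 + C2 * ENNReal.ofReal (logIntegral t ε)) := by
      gcongr
      exact h2 ε hε
    _ ≤ ENNReal.ofReal K * ((C1 + C2) * ENNReal.ofReal (1 + logIntegral t ε)) := by
      rw [add_mul]
      gcongr
      · exact le_mul_of_one_le_right zero_le (by simp [hJ])
      · linarith
    _ = _ := by
      rw [ENNReal.ofReal_mul (by positivity), ENNReal.ofReal_mul hK.le,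
        ENNReal.ofReal_toReal (ENNReal.add_ne_top.2 ⟨hC1, hC2⟩), mul_assoc]

/-! ### A jointly measurable version of the process and second moments of pathwise integrals -/

section GaussianPaths

variable {Ω : Type*} [MeasurableSpace Ω] {P : Measure Ω}

/-- A fractional Brownian motion with Hurst parameter `2 / 3`, all of whose paths are continuous
and all of whose marginals are measurable, extended to a process indexed by `ℝ`. -/
structure IsRegularFBM (W : ℝ → Ω → ℝ) (P : Measure Ω) : Prop where
  continuous : ∀ ω, Continuous fun x => W x ω
  measurable : ∀ x, Measurable (W x)
  isGaussianProcess : IsGaussianProcess W P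
  integral_eq_zero : ∀ x, ∫ ω, W x ω ∂P = 0
  integral_mul_eq : ∀ x y, 0 ≤ x → 0 ≤ y → ∫ ω, W x ω * W y ω ∂P =
    (x ^ (4 / 3 : ℝ) + y ^ (4 / 3 : ℝ) - |x - y| ^ (4 / 3 : ℝ)) / 2

/-- The paths are set to zero on a measurable null set containing every discontinuous path and every
failure of a measurable version along a dense sequence of times. Measurability at other times
follows by taking limits along that sequence. -/
theorem exists_measurable_continuous_modification {B : ℝ≥0 → Ω → ℝ}
    (hm : ∀ u, AEMeasurable (B u) P) (hc : ∀ᵐ ω ∂P, Continuous fun u => B u ω) :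
    ∃ B' : ℝ≥0 → Ω → ℝ, (∀ ω, Continuous fun u => B' u ω) ∧ (∀ u, Measurable (B' u)) ∧
      ∀ᵐ ω ∂P, ∀ u, B' u ω = B u ω := by
  have hgood : ∀ᵐ ω ∂P, (Continuous fun u => B u ω) ∧
      ∀ n : ℕ, B (TopologicalSpace.denseSeq ℝ≥0 n) ω =
        (hm (TopologicalSpace.denseSeq ℝ≥0 n)).mk _ ω :=
    hc.and (ae_all_iff.2 fun n => (hm _).ae_eq_mk)
  obtain ⟨N, hN, hNm, hN0⟩ := exists_measurable_superset_of_null hgood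
  have hNc : ∀ ω ∉ N, (Continuous fun u => B u ω) ∧
      ∀ n : ℕ, B (TopologicalSpace.denseSeq ℝ≥0 n) ω =
        (hm (TopologicalSpace.denseSeq ℝ≥0 n)).mk _ ω := by
    intro ω hω
    by_contra h
    exact hω (hN h)
  refine ⟨fun u => Nᶜ.indicator (B u), fun ω => ?_, fun u => ?_, ?_⟩
  · by_cases hω : ω ∈ N
    · simp [hω, continuous_const]
    · simpa [hω] using (hNc ω hω).1
  · have hd : ∀ n, Measurable (Nᶜ.indicator (B (TopologicalSpace.denseSeq ℝ≥0 n))) := by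
      intro n
      have : Nᶜ.indicator (B (TopologicalSpace.denseSeq ℝ≥0 n))
          = Nᶜ.indicator ((hm (TopologicalSpace.denseSeq ℝ≥0 n)).mk _) := by
        refine Set.indicator_congr fun ω hω => (hNc ω hω).2 n
      rw [this]
      exact ((hm _).measurable_mk).indicator hNm.compl
    obtain ⟨x, hx, hxu⟩ := mem_closure_iff_seq_limit.1
      ((TopologicalSpace.denseRange_denseSeq ℝ≥0) u)
    choose k hk using hx
    refine measurable_of_tendsto_metrizable (f := fun n => Nᶜ.indicator (B (x n)))
      (fun n => by rw [← hk n]; exact hd _) ?_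
    rw [tendsto_pi_nhds]
    intro ω
    by_cases hω : ω ∈ N
    · simp [hω]
    · simpa [hω, Function.comp_def] using ((hNc ω hω).1.tendsto u).comp hxu
  · have : ∀ᵐ ω ∂P, ω ∉ N := measure_eq_zero_iff_ae_notMem.1 hN0
    filter_upwards [this] with ω hω u
    simp [hω]

theorem IsFractionalBrownianMotion.exists_isRegularFBM {B : ℝ≥0 → Ω → ℝ}
    (hB : IsFractionalBrownianMotion B (2 / 3) P) :
    ∃ W : ℝ → Ω → ℝ, IsRegularFBM W P ∧ ∀ᵐ ω ∂P, ∀ x, W x ω = B x.toNNReal ω := by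
  obtain ⟨B', hc, hm, he⟩ := exists_measurable_continuous_modification
    (fun u => hB.isGaussianProcess.aemeasurable u) hB.continuous_paths
  have heu : ∀ u, B u =ᵐ[P] B' u := fun u => by filter_upwards [he] with ω hω using (hω u).symm
  refine ⟨fun x => B' x.toNNReal, ⟨fun ω => (hc ω).comp continuous_real_toNNReal,
    fun x => hm _, (hB.isGaussianProcess.congr heu).comp_right Real.toNNReal, fun x => ?_,
    fun x y hx hy => ?_⟩, ?_⟩
  · rw [← hB.integral_eq_zero x.toNNReal]
    exact integral_congr_ae (heu _).symm
  · have h := hB.integral_mul_eq x.toNNReal y.toNNReal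
    rw [Real.coe_toNNReal _ hx, Real.coe_toNNReal _ hy] at h
    norm_num at h
    rw [← h]
    exact integral_congr_ae ((heu _).symm.mul (heu _).symm)
  · filter_upwards [he] with ω hω x using hω _

namespace IsRegularFBM

variable {W : ℝ → Ω → ℝ} (hW : IsRegularFBM W P)
include hW

theorem hasGaussianLaw_increments (r s r' s' : ℝ) :
    HasGaussianLaw (fun ω => (W s ω - W r ω, W s' ω - W r' ω)) P := by
  have h : IsGaussianProcess (fun (p : ℝ × ℝ) ω => W p.2 ω - W p.1 ω) P := by
    classical
    refine hW.isGaussianProcess.of_isGaussianProcess fun p => ⟨{p.1, p.2},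
      ContinuousLinearMap.proj (R := ℝ) (φ := fun _ => ℝ) ⟨p.2, by simp⟩ -
        ContinuousLinearMap.proj (R := ℝ) (φ := fun _ => ℝ) ⟨p.1, by simp⟩, fun ω => ?_⟩
    simp
  exact h.hasGaussianLaw_prodMk (s := (r, s)) (t := (r', s'))

theorem memLp_two (x : ℝ) : MemLp (W x) 2 P :=
  (hW.isGaussianProcess.hasGaussianLaw_eval x).memLp_two

theorem integral_increment (r s : ℝ) : ∫ ω, (W s ω - W r ω) ∂P = 0 := by
  rw [integral_sub (hW.isGaussianProcess.hasGaussianLaw_eval s).integrable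
    (hW.isGaussianProcess.hasGaussianLaw_eval r).integrable, hW.integral_eq_zero,
    hW.integral_eq_zero, sub_zero]

theorem integral_increment_mul {r s r' s' : ℝ} (hr : 0 ≤ r) (hs : 0 ≤ s) (hr' : 0 ≤ r')
    (hs' : 0 ≤ s') :
    ∫ ω, (W s ω - W r ω) * (W s' ω - W r' ω) ∂P = incrCov r s r' s' := by
  have hi : ∀ x y, Integrable (fun ω => W x ω * W y ω) P := fun x y =>
    (hW.memLp_two x).integrable_mul (hW.memLp_two y)
  have e : ∀ ω, (W s ω - W r ω) * (W s' ω - W r' ω) =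
      (W s ω * W s' ω - W s ω * W r' ω) - (W r ω * W s' ω - W r ω * W r' ω) := by
    intro ω; ring
  simp_rw [e]
  have i1 : Integrable (fun ω => W s ω * W s' ω - W s ω * W r' ω) P := (hi _ _).sub (hi _ _)
  have i2 : Integrable (fun ω => W r ω * W s' ω - W r ω * W r' ω) P := (hi _ _).sub (hi _ _)
  rw [integral_sub i1 i2, integral_sub (hi _ _) (hi _ _), integral_sub (hi _ _) (hi _ _),
    hW.integral_mul_eq _ _ hs hs', hW.integral_mul_eq _ _ hs hr', hW.integral_mul_eq _ _ hr hs',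
    hW.integral_mul_eq _ _ hr hr', incrCov]
  ring

theorem integral_increment_mul_self {r s : ℝ} (hr : 0 ≤ r) (hs : 0 ≤ s) :
    ∫ ω, (W s ω - W r ω) * (W s ω - W r ω) ∂P = |s - r| ^ (4 / 3 : ℝ) := by
  rw [hW.integral_increment_mul hr hs hr hs, incrCov, abs_sub_comm r s]
  simp [Real.zero_rpow]

theorem measurable_uncurry : Measurable fun z : ℝ × Ω => W z.1 z.2 :=
  measurable_uncurry_of_continuous_of_measurable hW.continuous hW.measurable

theorem integral_abs_increment_le [IsProbabilityMeasure P] {r s : ℝ} (hr : 0 ≤ r) (hs : 0 ≤ s) :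
    ∫ ω, |W s ω - W r ω| ∂P ≤ |s - r| ^ (2 / 3 : ℝ) := by
  have hm : MemLp (fun ω => |W s ω - W r ω|) 2 P := ((hW.memLp_two s).sub (hW.memLp_two r)).abs
  have h := variance_nonneg (fun ω => |W s ω - W r ω|) P
  rw [variance_eq_sub hm] at h
  simp only [Pi.pow_apply, sq_abs] at h
  have h2 := hW.integral_increment_mul_self hr hs
  simp_rw [← pow_two] at h2
  rw [h2] at h
  refine (pow_le_pow_iff_left₀ (integral_nonneg fun ω => abs_nonneg _) (by positivity)
    two_ne_zero).1 ?_
  rw [← Real.rpow_natCast (|s - r| ^ (2 / 3 : ℝ)), ← Real.rpow_mul (abs_nonneg _)]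
  norm_num
  linarith

end IsRegularFBM

/-- Discards the negative part, so one-sided upper bounds on covariances suffice for second moments.
-/
theorem integral_le_of_lintegral_ofReal_le {S : Type*} [MeasurableSpace S] {μ : Measure S}
    {f : S → ℝ} (hf : Integrable f μ) {C : ℝ} (hC : 0 ≤ C)
    (h : ∫⁻ x, ENNReal.ofReal (f x) ∂μ ≤ ENNReal.ofReal C) : ∫ x, f x ∂μ ≤ C := by
  rw [integral_eq_lintegral_pos_part_sub_lintegral_neg_part hf]
  have h1 := ENNReal.toReal_mono ENNReal.ofReal_ne_top h
  rw [ENNReal.toReal_ofReal hC] at h1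
  have h2 : 0 ≤ (∫⁻ x, ENNReal.ofReal (-f x) ∂μ).toReal := ENNReal.toReal_nonneg
  linarith

/-- The second moment of an integral of random variables, bounded through their covariances. -/
theorem integral_sq_integral_le {S : Type*} [MeasurableSpace S] {μ : Measure S}
    [IsFiniteMeasure μ] [IsProbabilityMeasure P] {g : S → Ω → ℝ}
    (hg : Measurable fun z : S × Ω => g z.1 z.2) {M : ℝ}
    (hM : ∀ᵐ p ∂μ, Integrable (fun ω => g p ω ^ 2) P ∧ ∫ ω, g p ω ^ 2 ∂P ≤ M)
    {c : S → S → ℝ} (hc : ∀ᵐ p ∂μ, ∀ᵐ q ∂μ, ∫ ω, g p ω * g q ω ∂P = c p q)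
    {C : ℝ} (hC : 0 ≤ C) (h : ∫⁻ p, ∫⁻ q, ENNReal.ofReal (c p q) ∂μ ∂μ ≤ ENNReal.ofReal C) :
    Integrable (fun ω => (∫ p, g p ω ∂μ) ^ 2) P ∧ ∫ ω, (∫ p, g p ω ∂μ) ^ 2 ∂P ≤ C := by
  have hF : Measurable fun z : (S × S) × Ω => g z.1.1 z.2 * g z.1.2 z.2 :=
    (hg.comp (measurable_fst.fst.prodMk measurable_snd)).mul
      (hg.comp (measurable_fst.snd.prodMk measurable_snd))
  have hM1 : ∀ᵐ z ∂(μ.prod μ), Integrable (fun ω => g z.1 ω ^ 2) P ∧ ∫ ω, g z.1 ω ^ 2 ∂P ≤ M :=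
    Measure.quasiMeasurePreserving_fst.ae hM
  have hM2 : ∀ᵐ z ∂(μ.prod μ), Integrable (fun ω => g z.2 ω ^ 2) P ∧ ∫ ω, g z.2 ω ^ 2 ∂P ≤ M :=
    Measure.quasiMeasurePreserving_snd.ae hM
  have hm : ∀ p, Measurable (g p) := fun p => hg.comp measurable_prodMk_left
  have hprod : ∀ x y : ℝ, ‖x * y‖ ≤ (x ^ 2 + y ^ 2) / 2 := by
    intro x y
    rw [Real.norm_eq_abs, abs_mul]
    nlinarith [sq_nonneg (|x| - |y|), sq_abs x, sq_abs y]
  have hint : Integrable (fun z : (S × S) × Ω => g z.1.1 z.2 * g z.1.2 z.2)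
      ((μ.prod μ).prod P) := by
    rw [integrable_prod_iff hF.aestronglyMeasurable]
    constructor
    · filter_upwards [hM1, hM2] with z h1 h2
      exact Integrable.mono' ((h1.1.add h2.1).div_const 2) ((hm _).mul (hm _)).aestronglyMeasurable
        (ae_of_all _ fun ω => hprod _ _)
    · refine Integrable.of_bound (C := M)
        hF.aestronglyMeasurable.norm.integral_prod_right' ?_
      filter_upwards [hM1, hM2] with z h1 h2
      rw [Real.norm_of_nonneg (integral_nonneg fun ω => norm_nonneg _)]
      calc ∫ ω, ‖g z.1 ω * g z.2 ω‖ ∂P ≤ ∫ ω, (g z.1 ω ^ 2 + g z.2 ω ^ 2) / 2 ∂P :=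
            integral_mono_of_nonneg (ae_of_all _ fun ω => norm_nonneg _)
              ((h1.1.add h2.1).div_const 2) (ae_of_all _ fun ω => hprod _ _)
        _ ≤ M := by
          rw [integral_div, integral_add h1.1 h2.1]
          linarith [h1.2, h2.2]
  have hsq : ∀ ω, (∫ p, g p ω ∂μ) ^ 2 = ∫ z, g z.1 ω * g z.2 ω ∂(μ.prod μ) := by
    intro ω
    rw [integral_prod_mul (fun p => g p ω) (fun p => g p ω), pow_two]
  simp_rw [hsq]
  refine ⟨hint.integral_prod_right, ?_⟩
  rw [integral_integral_swap (f := fun ω (z : S × S) => g z.1 ω * g z.2 ω) hint.swap]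
  have hcz : ∀ᵐ p ∂μ, ∀ᵐ q ∂μ, ENNReal.ofReal (∫ ω, g p ω * g q ω ∂P) = ENNReal.ofReal (c p q) := by
    filter_upwards [hc] with p hp
    filter_upwards [hp] with q hq
    rw [hq]
  have hint2 := hint.integral_prod_left
  refine integral_le_of_lintegral_ofReal_le hint2 hC ?_
  rw [lintegral_prod _ hint2.aestronglyMeasurable.aemeasurable.ennreal_ofReal]
  refine le_trans (le_of_eq (lintegral_congr_ae ?_)) h
  filter_upwards [hcz] with p hp
  exact lintegral_congr_ae hp

theorem integral_abs_integral_le {S : Type*} [MeasurableSpace S] {μ : Measure S} [SFinite μ]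
    [SFinite P] {g : S → Ω → ℝ} (hg : Measurable fun z : S × Ω => g z.1 z.2)
    (hi : ∀ᵐ p ∂μ, Integrable (g p) P) {b : S → ℝ} (hb : ∀ᵐ p ∂μ, ∫ ω, |g p ω| ∂P ≤ b p)
    {C : ℝ} (hC : 0 ≤ C) (h : ∫⁻ p, ENNReal.ofReal (b p) ∂μ ≤ ENNReal.ofReal C) :
    Integrable (fun ω => ∫ p, g p ω ∂μ) P ∧ ∫ ω, |∫ p, g p ω ∂μ| ∂P ≤ C := by
  have key : ∫⁻ ω, ‖∫ p, g p ω ∂μ‖ₑ ∂P ≤ ENNReal.ofReal C := by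
    calc ∫⁻ ω, ‖∫ p, g p ω ∂μ‖ₑ ∂P ≤ ∫⁻ ω, ∫⁻ p, ‖g p ω‖ₑ ∂μ ∂P :=
          lintegral_mono fun ω => enorm_integral_le_lintegral_enorm _
      _ = ∫⁻ p, ∫⁻ ω, ‖g p ω‖ₑ ∂P ∂μ :=
          lintegral_lintegral_swap (hg.comp measurable_swap).enorm.aemeasurable
      _ ≤ ∫⁻ p, ENNReal.ofReal (b p) ∂μ := by
          refine lintegral_mono_ae ?_
          filter_upwards [hi, hb] with p h1 h2
          rw [← ofReal_integral_norm_eq_lintegral_enorm h1]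
          exact ENNReal.ofReal_le_ofReal h2
      _ ≤ _ := h
  have hm : StronglyMeasurable fun ω => ∫ p, g p ω ∂μ :=
    StronglyMeasurable.integral_prod_left' (f := fun z : S × Ω => g z.1 z.2) hg.stronglyMeasurable
  have hI : Integrable (fun ω => ∫ p, g p ω ∂μ) P :=
    ⟨hm.aestronglyMeasurable, key.trans_lt ENNReal.ofReal_lt_top⟩
  refine ⟨hI, ?_⟩
  have := ofReal_integral_norm_eq_lintegral_enorm hI
  rw [← this] at key
  exact (ENNReal.ofReal_le_ofReal_iff hC).1 key

end GaussianPaths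

/-! ### The first chaos and the remainder -/

/-- The coefficient of `B_s - B_r`, with `u = s - r`, in the first chaos of `-f_ε'(B_s - B_r)`. -/
noncomputable def chaosCoef (ε u : ℝ) : ℝ :=
  (√(2 * Real.pi))⁻¹ * (ε + |u| ^ (4 / 3 : ℝ)) ^ (-(3 / 2) : ℝ)

theorem continuous_chaosCoef {ε : ℝ} (hε : 0 < ε) : Continuous (chaosCoef ε) := by
  have h1 : Continuous fun u : ℝ => |u| ^ (4 / 3 : ℝ) :=
    continuous_abs.rpow_const fun _ => Or.inr (by norm_num)
  refine continuous_const.mul ((continuous_const.add h1).rpow_const fun u => Or.inl ?_)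
  have : ε + |u| ^ (4 / 3 : ℝ) ≠ 0 := by positivity
  exact this

theorem chaosCoef_nonneg {ε : ℝ} (hε : 0 < ε) (u : ℝ) : 0 ≤ chaosCoef ε u := by
  unfold chaosCoef; positivity

theorem chaosCoef_le_zero {ε : ℝ} (hε : 0 < ε) (u : ℝ) : chaosCoef ε u ≤ chaosCoef ε 0 := by
  unfold chaosCoef
  refine mul_le_mul_of_nonneg_left ?_ (by positivity)
  rw [abs_zero, Real.zero_rpow (by norm_num), add_zero]
  refine Real.rpow_le_rpow_of_nonpos hε ?_ (by norm_num)
  have : 0 ≤ |u| ^ (4 / 3 : ℝ) := by positivity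
  linarith

/-- This bound is uniform in `ε`, which is what makes the `L¹` error of the first chaos bounded. -/
theorem chaosCoef_le_rpow {ε : ℝ} (hε : 0 < ε) {u : ℝ} (hu : 0 < u) :
    chaosCoef ε u ≤ u ^ (-2 : ℝ) := by
  have h1 : (√(2 * Real.pi))⁻¹ ≤ 1 :=
    inv_le_one_of_one_le₀ (Real.one_le_sqrt.2 (by linarith [Real.pi_gt_three]))
  have h2 : (ε + |u| ^ (4 / 3 : ℝ)) ^ (-(3 / 2) : ℝ) ≤ (u ^ (4 / 3 : ℝ)) ^ (-(3 / 2) : ℝ) := by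
    rw [abs_of_pos hu]
    exact Real.rpow_le_rpow_of_nonpos (by positivity) (by linarith) (by norm_num)
  have h3 : (u ^ (4 / 3 : ℝ)) ^ (-(3 / 2) : ℝ) = u ^ (-2 : ℝ) := by
    rw [← Real.rpow_mul hu.le]; norm_num
  rw [h3] at h2
  unfold chaosCoef
  exact (mul_le_of_le_one_left (by positivity) h1).trans h2

section GaussianPaths

variable {Ω : Type*} [MeasurableSpace Ω] {P : Measure Ω}

/-- The part of chaos order at least three of `-f_ε'(B_s - B_r)`. -/
noncomputable def higherChaosPart (W : ℝ → Ω → ℝ) (ε : ℝ) (p : ℝ × ℝ) (ω : Ω) : ℝ :=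
  -heatKernelDeriv ε (W p.2 ω - W p.1 ω) - chaosCoef ε (p.2 - p.1) * (W p.2 ω - W p.1 ω)

namespace IsRegularFBM

variable {W : ℝ → Ω → ℝ} (hW : IsRegularFBM W P)
include hW

theorem integral_higherChaosPart_mul [IsProbabilityMeasure P] {t ε : ℝ} (hε : 0 < ε)
    {p q : ℝ × ℝ} (hp : p ∈ timeSimplex t) (hq : q ∈ timeSimplex t) :
    ∫ ω, higherChaosPart W ε p ω * higherChaosPart W ε q ω ∂P =
      higherChaosCov ε p.1 p.2 q.1 q.2 := by
  obtain ⟨p1, p2, p3⟩ := hp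
  obtain ⟨q1, q2, q3⟩ := hq
  obtain ⟨r, s⟩ := p
  obtain ⟨r', s'⟩ := q
  simp only at p1 p2 p3 q1 q2 q3 ⊢
  have hs : 0 ≤ s := by linarith
  have hs' : 0 ≤ s' := by linarith
  set X : Ω → ℝ := fun ω => W s ω - W r ω with hX
  set Y : Ω → ℝ := fun ω => W s' ω - W r' ω with hY
  set a := |s - r| ^ (4 / 3 : ℝ) with ha
  set b := |s' - r'| ^ (4 / 3 : ℝ) with hb
  set c := incrCov r s r' s' with hc
  have ha0 : 0 < a := Real.rpow_pos_of_pos (abs_pos.2 (by linarith)) _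
  have hb0 : 0 < b := Real.rpow_pos_of_pos (abs_pos.2 (by linarith)) _
  have hXY : HasGaussianLaw (fun ω => (X ω, Y ω)) P := hW.hasGaussianLaw_increments r s r' s'
  have hYX : HasGaussianLaw (fun ω => (Y ω, X ω)) P := hW.hasGaussianLaw_increments r' s' r s
  have eX0 : ∫ ω, X ω ∂P = 0 := hW.integral_increment r s
  have eY0 : ∫ ω, Y ω ∂P = 0 := hW.integral_increment r' s'
  have eXX : ∫ ω, X ω * X ω ∂P = a := hW.integral_increment_mul_self p1.le hs
  have eYY : ∫ ω, Y ω * Y ω ∂P = b := hW.integral_increment_mul_self q1.le hs'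
  have eXY : ∫ ω, X ω * Y ω ∂P = c := hW.integral_increment_mul p1.le hs q1.le hs'
  have eYX : ∫ ω, Y ω * X ω ∂P = c := by simp_rw [mul_comm (Y _)]; exact eXY
  have f1 := hXY.integral_heatKernelDeriv_mul eX0 eY0 ha0 eXX eYY eXY hε
  have f2 := hXY.integral_mul_heatKernelDeriv eX0 eY0 ha0 eXX eYY eXY hε
  have f3 := hYX.integral_mul_heatKernelDeriv eY0 eX0 hb0 eYY eXX eYX hε
  obtain ⟨K, hK0, hK⟩ := exists_abs_heatKernelDeriv_le ε
  have hcd := (continuous_heatKernelDeriv ε).measurable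
  have mX := (hcd.comp_aemeasurable hXY.fst.aemeasurable).aestronglyMeasurable
  have mY := (hcd.comp_aemeasurable hXY.snd.aemeasurable).aestronglyMeasurable
  have iY : Integrable (fun ω => heatKernelDeriv ε (Y ω)) P :=
    Integrable.of_bound (C := K) mY (ae_of_all _ fun ω => hK _)
  have i1 : Integrable (fun ω => heatKernelDeriv ε (X ω) * heatKernelDeriv ε (Y ω)) P :=
    iY.bdd_mul mX (ae_of_all _ fun ω => hK _)
  have i2 : Integrable (fun ω => heatKernelDeriv ε (X ω) * Y ω) P :=
    hXY.snd.integrable.bdd_mul mX (ae_of_all _ fun ω => hK _)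
  have i3 : Integrable (fun ω => heatKernelDeriv ε (Y ω) * X ω) P :=
    hXY.fst.integrable.bdd_mul mY (ae_of_all _ fun ω => hK _)
  have i4 : Integrable (fun ω => X ω * Y ω) P :=
    hXY.fst.memLp_two.integrable_mul hXY.snd.memLp_two
  set k := chaosCoef ε (s - r) with hk
  set k' := chaosCoef ε (s' - r') with hk'
  have e : ∀ ω, higherChaosPart W ε (r, s) ω * higherChaosPart W ε (r', s') ω =
      (heatKernelDeriv ε (X ω) * heatKernelDeriv ε (Y ω) + k' * (heatKernelDeriv ε (X ω) * Y ω)) +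
      (k * (heatKernelDeriv ε (Y ω) * X ω) + k * k' * (X ω * Y ω)) := by
    intro ω; simp only [higherChaosPart, hX, hY, hk, hk']; ring
  simp_rw [e]
  have j1 : Integrable (fun ω => heatKernelDeriv ε (X ω) * heatKernelDeriv ε (Y ω) +
      k' * (heatKernelDeriv ε (X ω) * Y ω)) P := i1.add (i2.const_mul _)
  have j2 : Integrable (fun ω => k * (heatKernelDeriv ε (Y ω) * X ω) + k * k' * (X ω * Y ω)) P :=
    (i3.const_mul _).add (i4.const_mul _)
  -- Each cross term contributes `-k k' c` and the product of the linear parts `+k k' c`. The net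
  -- `-k k' c` is the subtracted power in `higherChaosCov`.
  rw [integral_add j1 j2, integral_add i1 (i2.const_mul _),
    integral_add (i3.const_mul _) (i4.const_mul _), integral_const_mul, integral_const_mul,
    integral_const_mul, f1, f2, f3, eXY, higherChaosCov, ← ha, ← hb, ← hc,
    Real.mul_rpow (by positivity) (by positivity)]
  have hpi : (√(2 * Real.pi))⁻¹ * (√(2 * Real.pi))⁻¹ = (2 * Real.pi)⁻¹ := by
    rw [← mul_inv, Real.mul_self_sqrt (by positivity)]
  rw [← hpi]
  simp only [hk, hk', chaosCoef, ← ha, ← hb]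
  ring

theorem measurable_higherChaosPart {ε : ℝ} (hε : 0 < ε) :
    Measurable fun z : (ℝ × ℝ) × Ω => higherChaosPart W ε z.1 z.2 := by
  have h1 : Measurable fun z : (ℝ × ℝ) × Ω => W z.1.2 z.2 - W z.1.1 z.2 :=
    (hW.measurable_uncurry.comp (measurable_fst.snd.prodMk measurable_snd)).sub
      (hW.measurable_uncurry.comp (measurable_fst.fst.prodMk measurable_snd))
  have h2 := (continuous_heatKernelDeriv ε).measurable.comp h1
  have h3 := (continuous_chaosCoef hε).measurable.comp
    (measurable_fst.snd.sub measurable_fst.fst : Measurable fun z : (ℝ × ℝ) × Ω => z.1.2 - z.1.1)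
  exact h2.neg.sub (h3.mul h1)

/-- A crude bound, not uniform in `ε`; it only justifies Fubini for the second moment. -/
theorem exists_integral_sq_higherChaosPart_le [IsProbabilityMeasure P] {t ε : ℝ}
    (hε : 0 < ε) : ∃ M, ∀ p ∈ timeSimplex t, Integrable (fun ω => higherChaosPart W ε p ω ^ 2) P ∧
      ∫ ω, higherChaosPart W ε p ω ^ 2 ∂P ≤ M := by
  obtain ⟨K, hK0, hK⟩ := exists_abs_heatKernelDeriv_le ε
  refine ⟨2 * K ^ 2 + 2 * chaosCoef ε 0 ^ 2 * t ^ (4 / 3 : ℝ), fun p hp => ?_⟩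
  obtain ⟨p1, p2, p3⟩ := hp
  have hm : Measurable (higherChaosPart W ε p) :=
    (hW.measurable_higherChaosPart hε).comp measurable_prodMk_left
  have hG := hW.hasGaussianLaw_increments p.1 p.2 p.1 p.2
  have iXX : Integrable (fun ω => (W p.2 ω - W p.1 ω) * (W p.2 ω - W p.1 ω)) P :=
    hG.fst.memLp_two.integrable_mul hG.fst.memLp_two
  have hle : ∀ ω, higherChaosPart W ε p ω ^ 2 ≤
      2 * K ^ 2 + 2 * chaosCoef ε 0 ^ 2 * ((W p.2 ω - W p.1 ω) * (W p.2 ω - W p.1 ω)) := by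
    intro ω
    unfold higherChaosPart
    set x := W p.2 ω - W p.1 ω
    set k := chaosCoef ε (p.2 - p.1)
    have h1 : heatKernelDeriv ε x ^ 2 ≤ K ^ 2 := sq_le_sq' (by linarith [abs_le.1 (hK x)])
      (abs_le.1 (hK x)).2
    have h2 : k ^ 2 ≤ chaosCoef ε 0 ^ 2 :=
      pow_le_pow_left₀ (chaosCoef_nonneg hε _) (chaosCoef_le_zero hε _) 2
    have h3 := mul_le_mul_of_nonneg_right h2 (mul_self_nonneg x)
    have h4 := sq_nonneg (heatKernelDeriv ε x - k * x)
    linarith [h4]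
  have iB : Integrable (fun ω => 2 * K ^ 2 +
      2 * chaosCoef ε 0 ^ 2 * ((W p.2 ω - W p.1 ω) * (W p.2 ω - W p.1 ω))) P :=
    (integrable_const _).add (iXX.const_mul _)
  have iS : Integrable (fun ω => higherChaosPart W ε p ω ^ 2) P := by
    refine Integrable.mono' iB (hm.pow_const 2).aestronglyMeasurable (ae_of_all _ fun ω => ?_)
    rw [Real.norm_of_nonneg (sq_nonneg _)]
    exact hle ω
  refine ⟨iS, (integral_mono iS iB hle).trans ?_⟩
  rw [integral_add (integrable_const _) (iXX.const_mul _),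
    integral_const_mul (2 * chaosCoef ε 0 ^ 2), hW.integral_increment_mul_self p1.le (by linarith)]
  simp only [integral_const, probReal_univ, smul_eq_mul, one_mul]
  have : |p.2 - p.1| ^ (4 / 3 : ℝ) ≤ t ^ (4 / 3 : ℝ) := by
    refine Real.rpow_le_rpow (abs_nonneg _) ?_ (by norm_num)
    rw [abs_of_pos (by linarith)]; linarith
  gcongr

end IsRegularFBM

theorem timeSimplex_subset (t : ℝ) : timeSimplex t ⊆ Set.Icc 0 t ×ˢ Set.Icc 0 t := by
  rintro p ⟨h1, h2, h3⟩
  exact ⟨⟨h1.le, by linarith⟩, ⟨by linarith, h3.le⟩⟩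

theorem Continuous.integrableOn_timeSimplex {f : ℝ × ℝ → ℝ} (hf : Continuous f) (t : ℝ) :
    IntegrableOn f (timeSimplex t) :=
  (hf.continuousOn.integrableOn_compact (isCompact_Icc.prod isCompact_Icc)).mono_set
    (timeSimplex_subset t)

theorem volume_timeSimplex_lt_top (t : ℝ) : volume (timeSimplex t) < ∞ :=
  (measure_mono (timeSimplex_subset t)).trans_lt
    (isCompact_Icc.prod isCompact_Icc).measure_lt_top

/-- The part of chaos order at least three has second moment of order `log (1 / ε)`. -/
theorem IsRegularFBM.exists_integral_sq_integral_higherChaosPart_le [IsProbabilityMeasure P]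
    {W : ℝ → Ω → ℝ} (hW : IsRegularFBM W P) {t : ℝ} (ht : 0 ≤ t) :
    ∃ C, 0 ≤ C ∧ ∀ ε, 0 < ε →
      Integrable (fun ω => (∫ p in timeSimplex t, higherChaosPart W ε p ω) ^ 2) P ∧
      ∫ ω, (∫ p in timeSimplex t, higherChaosPart W ε p ω) ^ 2 ∂P ≤
        C * (1 + logIntegral t ε) := by
  obtain ⟨C, hC, h⟩ := exists_setLIntegral_higherChaosCov_le ht
  refine ⟨C, hC, fun ε hε => ?_⟩
  obtain ⟨M, hM⟩ := hW.exists_integral_sq_higherChaosPart_le (t := t) hε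
  have : IsFiniteMeasure ((volume : Measure (ℝ × ℝ)).restrict (timeSimplex t)) :=
    ⟨by rw [Measure.restrict_apply_univ]; exact volume_timeSimplex_lt_top t⟩
  have hD := self_mem_ae_restrict (μ := (volume : Measure (ℝ × ℝ))) (measurableSet_timeSimplex t)
  refine integral_sq_integral_le (hW.measurable_higherChaosPart hε) (M := M) ?_
    (c := fun p q => higherChaosCov ε p.1 p.2 q.1 q.2) ?_
    (mul_nonneg hC (by linarith [logIntegral_nonneg ht hε])) (h ε hε)
  · filter_upwards [hD] with p hp using hM p hp
  · filter_upwards [hD] with p hp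
    filter_upwards [hD] with q hq using hW.integral_higherChaosPart_mul hε hp hq

end GaussianPaths

/-! ### Telescoping the first chaos. -/

theorem Continuous.integral_timeSimplex {h : ℝ × ℝ → ℝ} (hh : Continuous h) {t : ℝ}
    (ht : 0 ≤ t) :
    ∫ p in timeSimplex t, h p = ∫ u in (0 : ℝ)..t, ∫ v in (0 : ℝ)..u, h (v, u) := by
  have hi := (hh.integrableOn_timeSimplex t).integrable_indicator (measurableSet_timeSimplex t)
  rw [← integral_indicator (measurableSet_timeSimplex t)]
  rw [Measure.volume_eq_prod] at hi ⊢
  rw [integral_prod_symm _ hi, intervalIntegral.integral_of_le ht, integral_Ioc_eq_integral_Ioo,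
    ← integral_indicator measurableSet_Ioo]
  congr 1 with u
  by_cases hu : u ∈ Set.Ioo 0 t
  · rw [Set.indicator_of_mem hu, intervalIntegral.integral_of_le hu.1.le,
      integral_Ioc_eq_integral_Ioo, ← integral_indicator measurableSet_Ioo]
    congr 1 with v
    by_cases hv : v ∈ Set.Ioo 0 u
    · rw [Set.indicator_of_mem hv,
        Set.indicator_of_mem (show (v, u) ∈ timeSimplex t from ⟨hv.1, hv.2, hu.2⟩)]
    · rw [Set.indicator_of_notMem hv,
        Set.indicator_of_notMem (fun h : (v, u) ∈ timeSimplex t => hv ⟨h.1, h.2.1⟩)]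
  · rw [Set.indicator_of_notMem hu]
    have : ∀ v, (timeSimplex t).indicator h (v, u) = 0 := fun v =>
      Set.indicator_of_notMem (fun h : (v, u) ∈ timeSimplex t =>
        hu ⟨lt_trans h.1 h.2.1, h.2.2⟩) _
    simp [this]

/-- For fixed `r` the reflection replaces the length `s - r` by `t - (s - r)`. Iterated integration
then has the length as outer variable and `r` as inner variable. -/
theorem Continuous.integral_timeSimplex_reflect {h : ℝ × ℝ → ℝ} (hh : Continuous h) (t : ℝ) :
    ∫ p in timeSimplex t, h p = ∫ p in timeSimplex t, h (p.1, p.1 + t - p.2) := by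
  have hh' : Continuous fun p : ℝ × ℝ => h (p.1, p.1 + t - p.2) := by fun_prop
  have hi := (hh.integrableOn_timeSimplex t).integrable_indicator (measurableSet_timeSimplex t)
  have hi' := (hh'.integrableOn_timeSimplex t).integrable_indicator (measurableSet_timeSimplex t)
  rw [← integral_indicator (measurableSet_timeSimplex t),
    ← integral_indicator (measurableSet_timeSimplex t)]
  rw [Measure.volume_eq_prod] at hi hi' ⊢
  rw [integral_prod _ hi, integral_prod _ hi']
  congr 1 with r
  rw [← integral_sub_left_eq_self (fun y => (timeSimplex t).indicator h (r, y)) volume (r + t)]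
  congr 1 with x
  have : (r, r + t - x) ∈ timeSimplex t ↔ (r, x) ∈ timeSimplex t := by
    constructor
    · rintro ⟨h1, h2, h3⟩
      simp only at h1 h2 h3
      exact ⟨h1, by simp only; linarith, by simp only; linarith⟩
    · rintro ⟨h1, h2, h3⟩
      simp only at h1 h2 h3
      exact ⟨h1, by simp only; linarith, by simp only; linarith⟩
  by_cases hx : (r, x) ∈ timeSimplex t
  · rw [Set.indicator_of_mem hx, Set.indicator_of_mem (this.2 hx)]
  · rw [Set.indicator_of_notMem hx, Set.indicator_of_notMem (fun h => hx (this.1 h))]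

/-- For fixed `u`, the integral of `w(r + u) - w(r)` over `0 < r < t - u` telescopes to the integral
of `w` over `[t - u, t]` minus that over `[0, u]`, that is, to the integral of `w(t - v) - w(v)`
over `0 < v < u`. -/
theorem integral_timeSimplex_increment {w k : ℝ → ℝ} (hw : Continuous w) (hk : Continuous k)
    {t : ℝ} (ht : 0 ≤ t) :
    ∫ p in timeSimplex t, k (p.2 - p.1) * (w p.2 - w p.1) =
      ∫ p in timeSimplex t, k p.2 * (w (t - p.1) - w p.1) := by
  rw [Continuous.integral_timeSimplex_reflect (by fun_prop),
    Continuous.integral_timeSimplex (by fun_prop) ht,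
    Continuous.integral_timeSimplex (by fun_prop) ht]
  simp only
  have h := intervalIntegral.integral_comp_sub_left (a := 0) (b := t)
    (fun u => ∫ r in (0 : ℝ)..(t - u), k u * (w (r + u) - w r)) t
  rw [sub_self, sub_zero] at h
  have h2 : ∫ x in (0 : ℝ)..t, ∫ r in (0 : ℝ)..x, k (r + t - x - r) * (w (r + t - x) - w r) =
      ∫ x in (0 : ℝ)..t, ∫ r in (0 : ℝ)..(t - (t - x)), k (t - x) * (w (r + (t - x)) - w r) := by
    refine intervalIntegral.integral_congr fun x _ => ?_
    rw [sub_sub_cancel]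
    refine intervalIntegral.integral_congr fun r _ => ?_
    rw [show r + t - x - r = t - x by ring, show r + t - x = r + (t - x) by ring]
  rw [h2, h]
  refine intervalIntegral.integral_congr fun u _ => ?_
  have hi : ∀ a b, IntervalIntegrable w volume a b := fun a b => hw.intervalIntegrable a b
  have i1 : IntervalIntegrable (fun r => w (r + u)) volume 0 (t - u) :=
    (by fun_prop : Continuous fun r => w (r + u)).intervalIntegrable _ _
  have i2 : IntervalIntegrable (fun v => w (t - v)) volume 0 u :=
    (by fun_prop : Continuous fun v => w (t - v)).intervalIntegrable _ _
  rw [intervalIntegral.integral_const_mul, intervalIntegral.integral_const_mul,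
    intervalIntegral.integral_sub i1 (hi _ _), intervalIntegral.integral_sub i2 (hi _ _),
    intervalIntegral.integral_comp_add_right, intervalIntegral.integral_comp_sub_left, zero_add,
    sub_add_cancel, sub_zero]
  have e1 := intervalIntegral.integral_add_adjacent_intervals (hi 0 u) (hi u t)
  have e2 := intervalIntegral.integral_add_adjacent_intervals (hi 0 (t - u)) (hi (t - u) t)
  congr 1
  linarith

theorem integral_timeSimplex_chaosCoef {t ε : ℝ} (ht : 0 ≤ t) (hε : 0 < ε) :
    ∫ p in timeSimplex t, chaosCoef ε p.2 = (√(2 * Real.pi))⁻¹ * logIntegral t ε := by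
  have hc := continuous_chaosCoef hε
  rw [Continuous.integral_timeSimplex (h := fun p => chaosCoef ε p.2) (by fun_prop) ht,
    logIntegral, ← intervalIntegral.integral_const_mul]
  refine intervalIntegral.integral_congr fun u hu => ?_
  rw [Set.uIcc_of_le ht] at hu
  simp only [intervalIntegral.integral_const, smul_eq_mul, sub_zero, chaosCoef]
  rw [abs_of_nonneg hu.1]
  ring

theorem setLIntegral_timeSimplex_rpow_mul_rpow_lt_top {α β : ℝ} (hα : -1 < α) (hβ : -1 < β)
    (t : ℝ) :
    ∫⁻ p in timeSimplex t, ENNReal.ofReal (p.1 ^ α * (p.2 - p.1) ^ β) < ∞ := by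
  set h : ℝ → ℝ → ℝ≥0∞ := fun γ =>
    (Set.Ioo 0 t).indicator (fun x : ℝ => ENNReal.ofReal (x ^ γ)) with hh
  have hm : ∀ γ, Measurable (h γ) := fun γ =>
    (by fun_prop : Measurable fun x : ℝ => ENNReal.ofReal (x ^ γ)).indicator measurableSet_Ioo
  have h1 : ∫⁻ p in timeSimplex t, ENNReal.ofReal (p.1 ^ α * (p.2 - p.1) ^ β) ≤
      ∫⁻ p : ℝ × ℝ, h α p.1 * h β (p.2 - p.1) := by
    refine (setLIntegral_mono' (measurableSet_timeSimplex t) fun p hp => ?_).trans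
      (setLIntegral_le_lintegral _ _)
    obtain ⟨h1, h2, h3⟩ := hp
    simp only [hh]
    rw [Set.indicator_of_mem (show p.1 ∈ Set.Ioo 0 t from ⟨h1, h2.trans h3⟩),
      Set.indicator_of_mem (show p.2 - p.1 ∈ Set.Ioo 0 t from ⟨by linarith, by linarith⟩),
      ENNReal.ofReal_mul (Real.rpow_nonneg h1.le _)]
  refine h1.trans_lt ?_
  rw [lintegral_prod_shear (hm α) (hm β)]
  exact ENNReal.mul_lt_top (lintegral_Ioo_rpow_lt_top hα t) (lintegral_Ioo_rpow_lt_top hβ t)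

section GaussianPaths

variable {Ω : Type*} [MeasurableSpace Ω] {P : Measure Ω}

/-- The first chaos is a multiple of `B_t - B_0` up to an error which is bounded in `L¹`. -/
theorem IsRegularFBM.exists_integral_abs_firstChaos_sub_le [IsProbabilityMeasure P]
    {W : ℝ → Ω → ℝ} (hW : IsRegularFBM W P) {t : ℝ} (ht : 0 ≤ t) :
    ∃ C, 0 ≤ C ∧ ∀ ε, 0 < ε →
      Integrable (fun ω => (∫ p in timeSimplex t, chaosCoef ε (p.2 - p.1) * (W p.2 ω - W p.1 ω)) -
        (√(2 * Real.pi))⁻¹ * logIntegral t ε * (W t ω - W 0 ω)) P ∧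
      ∫ ω, |(∫ p in timeSimplex t, chaosCoef ε (p.2 - p.1) * (W p.2 ω - W p.1 ω)) -
        (√(2 * Real.pi))⁻¹ * logIntegral t ε * (W t ω - W 0 ω)| ∂P ≤ C := by
  have hfin := setLIntegral_timeSimplex_rpow_mul_rpow_lt_top (α := -(2 / 3)) (β := -(2 / 3))
    (by norm_num) (by norm_num) t
  set I := ∫⁻ p in timeSimplex t, ENNReal.ofReal (p.1 ^ (-(2 / 3) : ℝ) *
    (p.2 - p.1) ^ (-(2 / 3) : ℝ)) with hI
  refine ⟨2 * I.toReal, mul_nonneg zero_le_two ENNReal.toReal_nonneg, fun ε hε => ?_⟩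
  have hk := continuous_chaosCoef hε
  -- Replacing `W (t - v) - W v` by `W t - W 0` leaves two increments of length `v`, each of `L¹`
  -- norm at most `v^{2/3}`.
  have hkey : ∀ ω, (∫ p in timeSimplex t, chaosCoef ε (p.2 - p.1) * (W p.2 ω - W p.1 ω)) -
      (√(2 * Real.pi))⁻¹ * logIntegral t ε * (W t ω - W 0 ω) =
      ∫ p in timeSimplex t, chaosCoef ε p.2 *
        ((W (t - p.1) ω - W t ω) - (W p.1 ω - W 0 ω)) := by
    intro ω
    have hw := hW.continuous ω
    rw [integral_timeSimplex_increment hw hk ht, ← integral_timeSimplex_chaosCoef ht hε,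
      ← integral_mul_const, ← integral_sub]
    · congr 1 with p; ring
    · exact Continuous.integrableOn_timeSimplex (by fun_prop) t
    · exact Continuous.integrableOn_timeSimplex (by fun_prop) t
  simp_rw [hkey]
  have mW := hW.measurable_uncurry
  have hg : Measurable fun z : (ℝ × ℝ) × Ω => chaosCoef ε z.1.2 *
      ((W (t - z.1.1) z.2 - W t z.2) - (W z.1.1 z.2 - W 0 z.2)) := by
    have a1 : Measurable fun z : (ℝ × ℝ) × Ω => W (t - z.1.1) z.2 :=
      mW.comp ((measurable_const.sub measurable_fst.fst).prodMk measurable_snd)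
    have a2 : Measurable fun z : (ℝ × ℝ) × Ω => W z.1.1 z.2 :=
      mW.comp (measurable_fst.fst.prodMk measurable_snd)
    exact (hk.measurable.comp measurable_fst.snd).mul
      ((a1.sub ((hW.measurable t).comp measurable_snd)).sub
        (a2.sub ((hW.measurable 0).comp measurable_snd)))
  have iinc : ∀ x y, Integrable (fun ω => W x ω - W y ω) P := fun x y =>
    (hW.isGaussianProcess.hasGaussianLaw_eval x).integrable.sub
      (hW.isGaussianProcess.hasGaussianLaw_eval y).integrable
  refine integral_abs_integral_le hg (b := fun p => 2 * (p.1 ^ (-(2 / 3) : ℝ) *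
    (p.2 - p.1) ^ (-(2 / 3) : ℝ))) (ae_of_all _ fun p => ((iinc _ _).sub (iinc _ _)).const_mul _)
    ?_ (mul_nonneg zero_le_two ENNReal.toReal_nonneg) ?_
  · filter_upwards [self_mem_ae_restrict (measurableSet_timeSimplex t)] with p hp
    obtain ⟨p1, p2, p3⟩ := hp
    have hp2 : 0 < p.2 := p1.trans p2
    have e1 : ∀ ω, |chaosCoef ε p.2 * ((W (t - p.1) ω - W t ω) - (W p.1 ω - W 0 ω))| ≤
        chaosCoef ε p.2 * (|W (t - p.1) ω - W t ω| + |W p.1 ω - W 0 ω|) := by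
      intro ω
      rw [abs_mul, abs_of_nonneg (chaosCoef_nonneg hε _)]
      exact mul_le_mul_of_nonneg_left (abs_sub _ _) (chaosCoef_nonneg hε _)
    have b1 := hW.integral_abs_increment_le (r := t) (s := t - p.1) ht (by linarith)
    have b2 := hW.integral_abs_increment_le (r := 0) (s := p.1) le_rfl p1.le
    rw [show t - p.1 - t = -p.1 by ring, abs_neg, abs_of_pos p1] at b1
    rw [sub_zero, abs_of_pos p1] at b2
    -- Since `v < u`, the quantity `u^{-2} v^{2/3}` is at most `u^{-4/3}`; splitting this as
    -- `u^{-2/3} u^{-2/3}` gives a bound by integrable powers of `v` and `u - v`.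
    have hpow : p.2 ^ (-2 : ℝ) * p.1 ^ (2 / 3 : ℝ) ≤
        p.1 ^ (-(2 / 3) : ℝ) * (p.2 - p.1) ^ (-(2 / 3) : ℝ) := by
      have c1 : p.1 ^ (2 / 3 : ℝ) ≤ p.2 ^ (2 / 3 : ℝ) :=
        Real.rpow_le_rpow p1.le p2.le (by norm_num)
      have c2 : p.2 ^ (-(2 / 3) : ℝ) ≤ p.1 ^ (-(2 / 3) : ℝ) :=
        Real.rpow_le_rpow_of_nonpos p1 p2.le (by norm_num)
      have c3 : p.2 ^ (-(2 / 3) : ℝ) ≤ (p.2 - p.1) ^ (-(2 / 3) : ℝ) :=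
        Real.rpow_le_rpow_of_nonpos (by linarith) (by linarith) (by norm_num)
      have c4 : p.2 ^ (-2 : ℝ) * p.2 ^ (2 / 3 : ℝ) =
          p.2 ^ (-(2 / 3) : ℝ) * p.2 ^ (-(2 / 3) : ℝ) := by
        rw [← Real.rpow_add hp2, ← Real.rpow_add hp2]; norm_num
      calc _ ≤ p.2 ^ (-2 : ℝ) * p.2 ^ (2 / 3 : ℝ) := by gcongr
        _ = _ := c4
        _ ≤ _ := mul_le_mul c2 c3 (by positivity) (by positivity)
    calc _ ≤ ∫ ω, chaosCoef ε p.2 * (|W (t - p.1) ω - W t ω| + |W p.1 ω - W 0 ω|) ∂P :=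
          integral_mono_of_nonneg (ae_of_all _ fun ω => abs_nonneg _)
            (((iinc _ _).abs.add (iinc _ _).abs).const_mul _) (ae_of_all _ e1)
      _ = chaosCoef ε p.2 * ((∫ ω, |W (t - p.1) ω - W t ω| ∂P) + ∫ ω, |W p.1 ω - W 0 ω| ∂P) := by
          rw [integral_const_mul, integral_add (iinc _ _).abs (iinc _ _).abs]
      _ ≤ p.2 ^ (-2 : ℝ) * (p.1 ^ (2 / 3 : ℝ) + p.1 ^ (2 / 3 : ℝ)) :=
          mul_le_mul (chaosCoef_le_rpow hε hp2) (add_le_add b1 b2)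
            (add_nonneg (integral_nonneg fun _ => abs_nonneg _)
              (integral_nonneg fun _ => abs_nonneg _)) (by positivity)
      _ ≤ _ := by linarith
  · simp_rw [ENNReal.ofReal_mul (zero_le_two (α := ℝ))]
    rw [lintegral_const_mul _ (by fun_prop), ENNReal.ofReal_toReal hfin.ne]

end GaussianPaths

/-! ### Convergence in `L¹` and identification of the limit law. -/

/-- This value reconciles the two forms of the variance: `(3/4)² / (2π) = (9/4) / (8π)`. -/
theorem beta_two_one_third : ProbabilityTheory.beta 2 (1 / 3) = 9 / 4 := by
  have h1 : Real.Gamma (2 + 1 / 3) = 4 / 3 * (1 / 3 * Real.Gamma (1 / 3)) := by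
    rw [← Real.Gamma_add_one (by norm_num), show (1 / 3 + 1 : ℝ) = 4 / 3 by norm_num,
      ← Real.Gamma_add_one (by norm_num)]
    norm_num
  have h2 : 0 < Real.Gamma (1 / 3) := Real.Gamma_pos_of_pos (by norm_num)
  rw [ProbabilityTheory.beta, h1, Real.Gamma_two]
  field_simp
  norm_num

theorem approxDSLT_one_eq {Ω : Type*} {B : ℝ≥0 → Ω → ℝ} {W : ℝ → Ω → ℝ} {ω : Ω}
    (h : ∀ x, W x ω = B x.toNNReal ω) (t ε : ℝ) :
    approxDSLT B 1 t ε 0 ω = -∫ p in timeSimplex t, heatKernelDeriv ε (W p.2 ω - W p.1 ω) := by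
  simp_rw [approxDSLT, iteratedDeriv_one_heatKernel, sub_zero, h, pow_one, neg_one_mul]

section GaussianPaths

variable {Ω : Type*} [MeasurableSpace Ω] {P : Measure Ω}

namespace IsRegularFBM

variable {W : ℝ → Ω → ℝ} (hW : IsRegularFBM W P)
include hW

theorem stronglyMeasurable_integral_heatKernelDeriv (t ε : ℝ) : StronglyMeasurable
    fun ω => ∫ p in timeSimplex t, heatKernelDeriv ε (W p.2 ω - W p.1 ω) := by
  have h1 : Measurable fun z : (ℝ × ℝ) × Ω => W z.1.2 z.2 - W z.1.1 z.2 :=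
    (hW.measurable_uncurry.comp (measurable_fst.snd.prodMk measurable_snd)).sub
      (hW.measurable_uncurry.comp (measurable_fst.fst.prodMk measurable_snd))
  exact StronglyMeasurable.integral_prod_left'
    (f := fun z : (ℝ × ℝ) × Ω => heatKernelDeriv ε (W z.1.2 z.2 - W z.1.1 z.2))
    ((continuous_heatKernelDeriv ε).measurable.comp h1).stronglyMeasurable

theorem neg_integral_heatKernelDeriv_eq (t : ℝ) {ε : ℝ} (hε : 0 < ε) (ω : Ω) :
    -∫ p in timeSimplex t, heatKernelDeriv ε (W p.2 ω - W p.1 ω) =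
      (∫ p in timeSimplex t, higherChaosPart W ε p ω) +
        ∫ p in timeSimplex t, chaosCoef ε (p.2 - p.1) * (W p.2 ω - W p.1 ω) := by
  have hw := hW.continuous ω
  have hk := continuous_chaosCoef hε
  have hd := continuous_heatKernelDeriv ε
  rw [← integral_neg, ← integral_add]
  · congr 1 with p
    unfold higherChaosPart
    ring
  · unfold higherChaosPart
    exact Continuous.integrableOn_timeSimplex (by fun_prop) t
  · exact Continuous.integrableOn_timeSimplex (by fun_prop) t

theorem exists_integral_abs_sub_le [IsProbabilityMeasure P] {t : ℝ} (ht : 0 ≤ t) :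
    ∃ C D, ∀ ε, 0 < ε →
      Integrable (fun ω => -(∫ p in timeSimplex t, heatKernelDeriv ε (W p.2 ω - W p.1 ω)) -
        (√(2 * Real.pi))⁻¹ * logIntegral t ε * (W t ω - W 0 ω)) P ∧
      ∫ ω, |-(∫ p in timeSimplex t, heatKernelDeriv ε (W p.2 ω - W p.1 ω)) -
        (√(2 * Real.pi))⁻¹ * logIntegral t ε * (W t ω - W 0 ω)| ∂P ≤
        √(C * (1 + logIntegral t ε)) + D := by
  obtain ⟨C, hC, h1⟩ := hW.exists_integral_sq_integral_higherChaosPart_le ht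
  obtain ⟨D, hD, h2⟩ := hW.exists_integral_abs_firstChaos_sub_le ht
  refine ⟨C, D, fun ε hε => ?_⟩
  obtain ⟨i1, b1⟩ := h1 ε hε
  obtain ⟨i2, b2⟩ := h2 ε hε
  set R : Ω → ℝ := fun ω => ∫ p in timeSimplex t, higherChaosPart W ε p ω with hR
  have mR : AEStronglyMeasurable R P :=
    (StronglyMeasurable.integral_prod_left'
      (f := fun z : (ℝ × ℝ) × Ω => higherChaosPart W ε z.1 z.2)
      (hW.measurable_higherChaosPart hε).stronglyMeasurable).aestronglyMeasurable
  have hR2 : MemLp R 2 P := (memLp_two_iff_integrable_sq mR).2 i1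
  have iR : Integrable R P := hR2.integrable one_le_two
  have hRle : ∫ ω, |R ω| ∂P ≤ √(C * (1 + logIntegral t ε)) := by
    refine Real.le_sqrt_of_sq_le (le_trans ?_ b1)
    have hRa : MemLp (fun ω => |R ω|) 2 P := hR2.abs
    have h := variance_nonneg (fun ω => |R ω|) P
    rw [variance_eq_sub hRa] at h
    simp only [Pi.pow_apply, sq_abs] at h
    linarith
  simp_rw [hW.neg_integral_heatKernelDeriv_eq t hε, add_sub_assoc]
  refine ⟨iR.add i2, ?_⟩
  refine (integral_mono (iR.add i2).abs (iR.abs.add i2.abs) fun ω => abs_add_le _ _).trans ?_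
  rw [integral_add' iR.abs i2.abs]
  exact add_le_add hRle b2

theorem tendsto_integral_abs_sub [IsProbabilityMeasure P] {t : ℝ} (ht : 0 < t) :
    Tendsto (fun ε => ∫ ω, |(Real.log (1 / ε))⁻¹ *
        (-∫ p in timeSimplex t, heatKernelDeriv ε (W p.2 ω - W p.1 ω)) -
        3 / 4 * (√(2 * Real.pi))⁻¹ * (W t ω - W 0 ω)| ∂P) (𝓝[>] 0) (𝓝 0) ∧
    ∀ ε, 0 < ε → Integrable (fun ω => (Real.log (1 / ε))⁻¹ *
        (-∫ p in timeSimplex t, heatKernelDeriv ε (W p.2 ω - W p.1 ω)) -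
        3 / 4 * (√(2 * Real.pi))⁻¹ * (W t ω - W 0 ω)) P := by
  obtain ⟨C, D, h⟩ := hW.exists_integral_abs_sub_le ht.le
  have iX : Integrable (fun ω => W t ω - W 0 ω) P :=
    (hW.isGaussianProcess.hasGaussianLaw_eval t).integrable.sub
      (hW.isGaussianProcess.hasGaussianLaw_eval 0).integrable
  have hlog : Tendsto (fun ε : ℝ => Real.log (1 / ε)) (𝓝[>] 0) atTop := by
    simp_rw [one_div, Real.log_inv]
    exact tendsto_neg_atBot_atTop.comp Real.tendsto_log_nhdsGT_zero
  set σ := (√(2 * Real.pi))⁻¹ with hσ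
  set J : ℝ → ℝ := logIntegral t with hJ
  obtain ⟨L, hL⟩ : ∃ L : ℝ → ℝ, ∀ ε, (Real.log (1 / ε))⁻¹ = L ε := ⟨_, fun _ => rfl⟩
  have hL0 : Tendsto L (𝓝[>] 0) (𝓝 0) := by
    simpa only [Function.comp_def, hL] using tendsto_inv_atTop_zero.comp hlog
  have hLJ : Tendsto (fun ε => L ε * J ε) (𝓝[>] 0) (𝓝 (3 / 4)) := by
    simpa only [hL] using tendsto_logIntegral ht
  set E : ℝ → Ω → ℝ := fun ε ω =>
    -(∫ p in timeSimplex t, heatKernelDeriv ε (W p.2 ω - W p.1 ω)) -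
      σ * J ε * (W t ω - W 0 ω) with hE
  have hdec : ∀ ε ω, L ε * (-∫ p in timeSimplex t, heatKernelDeriv ε (W p.2 ω - W p.1 ω)) -
      3 / 4 * σ * (W t ω - W 0 ω) =
      L ε * E ε ω + σ * (L ε * J ε - 3 / 4) * (W t ω - W 0 ω) := by
    intro ε ω; simp only [hE]; ring
  simp_rw [hL, hdec]
  have hint : ∀ ε, 0 < ε → Integrable (fun ω => L ε * E ε ω +
      σ * (L ε * J ε - 3 / 4) * (W t ω - W 0 ω)) P := fun ε hε =>
    ((h ε hε).1.const_mul _).add (iX.const_mul _)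
  refine ⟨?_, hint⟩
  -- The factor `L` is moved under the root: there `L²` and `L (L J)` both vanish, because `L → 0`
  -- while `L J` converges.
  have hbound : Tendsto (fun ε => √(C * (L ε * L ε + L ε * (L ε * J ε))) + L ε * D +
      |σ * (L ε * J ε - 3 / 4)| * ∫ ω, |W t ω - W 0 ω| ∂P) (𝓝[>] 0) (𝓝 0) := by
    have t1 := ((((hL0.mul hL0).add (hL0.mul hLJ)).const_mul C).sqrt).add (hL0.mul_const D)
    have t2 := (((hLJ.sub_const (3 / 4)).const_mul σ).abs).mul_const (∫ ω, |W t ω - W 0 ω| ∂P)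
    simpa using t1.add t2
  refine squeeze_zero' (Eventually.of_forall fun ε => integral_nonneg fun ω => abs_nonneg _) ?_
    hbound
  filter_upwards [self_mem_nhdsWithin, hlog.eventually_gt_atTop 0] with ε hε hLε
  have hε : 0 < ε := hε
  have hLp : 0 ≤ L ε := hL ε ▸ inv_nonneg.2 hLε.le
  have hsq : L ε * √(C * (1 + J ε)) = √(C * (L ε * L ε + L ε * (L ε * J ε))) := by
    rw [show C * (L ε * L ε + L ε * (L ε * J ε)) = L ε ^ 2 * (C * (1 + J ε)) by ring,
      Real.sqrt_mul (sq_nonneg _), Real.sqrt_sq hLp]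
  have iE := (h ε hε).1
  calc ∫ ω, |L ε * E ε ω + σ * (L ε * J ε - 3 / 4) * (W t ω - W 0 ω)| ∂P
      ≤ ∫ ω, (L ε * |E ε ω| + |σ * (L ε * J ε - 3 / 4)| * |W t ω - W 0 ω|) ∂P := by
        refine integral_mono (hint ε hε).abs
          ((iE.abs.const_mul _).add (iX.abs.const_mul _)) fun ω => ?_
        refine (abs_add_le _ _).trans ?_
        rw [abs_mul, abs_mul _ (W t ω - W 0 ω), abs_of_nonneg hLp]
    _ = L ε * (∫ ω, |E ε ω| ∂P) +
        |σ * (L ε * J ε - 3 / 4)| * ∫ ω, |W t ω - W 0 ω| ∂P := by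
        rw [integral_add (iE.abs.const_mul _) (iX.abs.const_mul _), integral_const_mul,
          integral_const_mul]
    _ ≤ L ε * (√(C * (1 + J ε)) + D) +
        |σ * (L ε * J ε - 3 / 4)| * ∫ ω, |W t ω - W 0 ω| ∂P := by
        have := mul_le_mul_of_nonneg_left (h ε hε).2 hLp
        linarith
    _ = _ := by rw [mul_add, hsq]

theorem map_limit_eq {t : ℝ} (ht : 0 ≤ t) :
    P.map (fun ω => 3 / 4 * (√(2 * Real.pi))⁻¹ * (W t ω - W 0 ω)) =
      gaussianReal 0
        (t ^ (4 / 3 : ℝ) / (8 * Real.pi) * ProbabilityTheory.beta 2 (1 / 3)).toNNReal := by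
  have hG := (hW.hasGaussianLaw_increments 0 t 0 t).fst.fun_smul (3 / 4 * (√(2 * Real.pi))⁻¹)
  simp only [smul_eq_mul] at hG
  refine hG.map_eq_gaussianReal_of_centered ?_ ?_
  · rw [integral_const_mul, hW.integral_increment, mul_zero]
  · have e : ∀ ω, 3 / 4 * (√(2 * Real.pi))⁻¹ * (W t ω - W 0 ω) *
        (3 / 4 * (√(2 * Real.pi))⁻¹ * (W t ω - W 0 ω)) =
        9 / 16 * ((√(2 * Real.pi))⁻¹ * (√(2 * Real.pi))⁻¹) *
          ((W t ω - W 0 ω) * (W t ω - W 0 ω)) := by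
      intro ω; ring
    simp_rw [e]
    rw [integral_const_mul, hW.integral_increment_mul_self le_rfl ht, ← mul_inv,
      Real.mul_self_sqrt (by positivity), sub_zero, abs_of_nonneg ht, beta_two_one_third]
    field_simp
    ring

end IsRegularFBM

end GaussianPaths

theorem theorem1p4 {Ω : Type*} [MeasurableSpace Ω] (P : Measure Ω) [IsProbabilityMeasure P]
    (B : ℝ≥0 → Ω → ℝ) (hB : IsFractionalBrownianMotion B (2 / 3) P) (t : ℝ) (ht : 0 < t) :
    TendstoInDistribution
      (fun (ε : ℝ) (ω : Ω) => (Real.log (1 / ε))⁻¹ * approxDSLT B 1 t ε 0 ω)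
      (𝓝[>] (0 : ℝ)) (id : ℝ → ℝ) (fun _ => P)
      (gaussianReal 0 (t ^ (4 / 3 : ℝ) / (8 * Real.pi) * ProbabilityTheory.beta 2 (1 / 3)).toNNReal) := by
  obtain ⟨W, hW, hWB⟩ := hB.exists_isRegularFBM
  set X : ℝ → Ω → ℝ := fun ε ω => (Real.log (1 / ε))⁻¹ * approxDSLT B 1 t ε 0 ω with hX
  set Z : Ω → ℝ := fun ω => 3 / 4 * (√(2 * Real.pi))⁻¹ * (W t ω - W 0 ω) with hZ
  have hXW : ∀ ε, X ε =ᵐ[P] fun ω => (Real.log (1 / ε))⁻¹ *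
      (-∫ p in timeSimplex t, heatKernelDeriv ε (W p.2 ω - W p.1 ω)) := by
    intro ε
    filter_upwards [hWB] with ω hω
    rw [hX, ← approxDSLT_one_eq hω]
  have mX : ∀ ε, AEMeasurable (X ε) P := fun ε =>
    (((hW.stronglyMeasurable_integral_heatKernelDeriv t ε).measurable.neg.const_mul
      _).aemeasurable).congr (hXW ε).symm
  have mZ : Measurable Z := ((hW.measurable t).sub (hW.measurable 0)).const_mul _
  obtain ⟨hlim, hint⟩ := hW.tendsto_integral_abs_sub ht
  -- Convergence in `L¹` implies convergence in measure, hence in distribution.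
  have hmeas : TendstoInMeasure P X (𝓝[>] 0) Z := by
    refine tendstoInMeasure_of_tendsto_eLpNorm one_ne_zero
      (fun ε => (mX ε).aestronglyMeasurable) mZ.aestronglyMeasurable ?_
    have h0 := ENNReal.tendsto_ofReal hlim
    rw [ENNReal.ofReal_zero] at h0
    refine h0.congr' ?_
    filter_upwards [self_mem_nhdsWithin] with ε hε
    rw [eLpNorm_one_eq_lintegral_enorm]
    have h1 := ofReal_integral_norm_eq_lintegral_enorm (hint ε hε)
    simp only [Real.norm_eq_abs] at h1
    rw [h1]
    refine lintegral_congr_ae ?_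
    filter_upwards [hXW ε] with ω hω
    rw [Pi.sub_apply, hω]
  have hdist := hmeas.tendstoInDistribution mX
  -- The limit is presented as the identity under the Gaussian measure; only its law matters, and it
  -- is the law of `Z`.
  refine ⟨mX, aemeasurable_id, ?_⟩
  have hlaw := hW.map_limit_eq ht.le
  convert hdist.tendsto using 2
  refine congrArg 𝓝 (Subtype.ext ?_)
  change Measure.map id _ = _
  rw [Measure.map_id]
  exact hlaw.symm
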